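/- **Theorem.** Let $r>1$, $\alpha>1$, $\kappa>0$. Let $u$ be analytic in the annulus $r^{-1}\le|z|\le r$ cut along the real interval $[r^{-1},r]$, and assume that there are constants $u(1),u(e^{2\pi i}),C_3,C_4\in\mathbb C$ (the first two are the one-sided values of $u$ at the two ends of the cut circle) such that, as $t\to0$ in the complex sector $|\operatorname{Im}t|<\kappa\operatorname{Re}t$, $$u(e^{it})=u(1)+C_3t^{\alpha-1}+o(|t|^{\alpha-1}),\qquad u(e^{i(2\pi-t)})=u(e^{2\pi i})+C_4t^{\alpha-1}+o(|t|^{\alpha-1}).$$ Let $K$ be analytic on the unit circle $|z|=1$, with Laurent coefficients $c_k=\frac1{2\pi i}\int_{|z|=1}K(z)z^{-k-1}dz$, and put $$K_n(z)=\tfrac12c_{-n}z^{-n}+\sum_{k=-n+1}^{n-1}c_kz^k+\tfrac12c_nz^n,$$ $$K_n^+(z)=\tfrac12c_nz^n+\sum_{k\ge n+1}c_kz^k,\qquad K_n^-(z)=\sum_{k\le-n-1}c_kz^k+\tfrac12c_{-n}z^{-n},$$ and $z_-^n=z^{-n}$ for $|z|\ge1$, $z_-^n=z^n$ for $|z|<1$.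 Let $$I(Ku)=\int_0^{2\pi}K(e^{it})u(e^{it})\,dt,\qquad T_{2n}(K_nu)=\frac{\pi}{n}\sum_{k=0}^{2n}{}''\,(K_nu)(e^{\pi ik/n}),$$ where $\sum''$ means that the first and last terms are halved and are formed with the values $u(1)$ and $u(e^{2\pi i})$, respectively. Then the integral $I(Ku)$ exists, there is a $\rho\in(1,r]$ such that $K$ is analytic in the closed annulus $\rho^{-1}\le|z|\le\rho$, and for every such $\rho$ (in particular for $\rho=r$ if $K$ is analytic in $r^{-1}\le|z|\le r$), $$T_{2n}(K_nu)-I(Ku)=\mathrm{p.v.}\!\int_{\rho^{-1}}^{\rho}\frac{z_-^nK(z)-z^{-n}K_n^+(z)-z^nK_n^-(z)}{z^n-z^{-n}}\,\bigl(u(1)-u(e^{2\pi i})\bigr)\frac{dz}{iz}+O(n^{-\alpha}),\qquad n\to\infty,$$ where, for every $n\ge1$, the integral along the real interval exists as a Cauchy principal value at $z=1$. -/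

import Mathlib

open Complex Filter Topology Asymptotics MeasureTheory

noncomputable section

namespace ModifiedTrapezoid

/-- The closed annulus `r⁻¹ ≤ |z| ≤ r`. -/
def annulus (r : ℝ) : Set ℂ := {z | r⁻¹ ≤ ‖z‖ ∧ ‖z‖ ≤ r}

/-- The closed annulus `r⁻¹ ≤ |z| ≤ r` cut along the real interval `[r⁻¹, r]`. -/
def cutAnnulus (r : ℝ) : Set ℂ := annulus r \ (Complex.ofReal '' Set.Icc r⁻¹ r)

/-- The open sector `|Im t| < κ Re t` with vertex `0`, symmetric about the positive real axis. -/
def sector (κ : ℝ) : Set ℂ := {t | |t.im| < κ * t.re}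

/-- `I(g) = ∫₀^{2π} g(e^{it}) dt`. -/
def circleInt (g : ℂ → ℂ) : ℂ := ∫ t in (0 : ℝ)..(2 * Real.pi), g (exp (I * t))

/-- The non-periodic trapezoidal rule with `m` subintervals,
`(2π/m) ∑''_{k=0}^m g(e^{2πik/m})`, the first and last term being halved. The function `g` lives on
the circle cut at `1`; its values `g(1)` and `g(e^{2πi})` at the two ends are `g₀` and `g₁`. -/
def trapezoid (m : ℕ) (g : ℂ → ℂ) (g₀ g₁ : ℂ) : ℂ :=
  2 * Real.pi / m *
    (g₀ / 2 + ∑ k ∈ Finset.Ico 1 m, g (exp (2 * Real.pi * I * k / m)) + g₁ / 2)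

/-- The Laurent coefficient `c_k = (1/2πi) ∫_{|z|=1} K(z) z^{-k-1} dz`. -/
def laurentCoeff (K : ℂ → ℂ) (k : ℤ) : ℂ :=
  1 / (2 * Real.pi * I) * ∮ z in C(0, 1), K z * z ^ (-k - 1)

/-- `K_n(z) = ½ c_{-n} z^{-n} + ∑_{k=-n+1}^{n-1} c_k z^k + ½ c_n z^n`. -/
def laurentMid (K : ℂ → ℂ) (n : ℕ) (z : ℂ) : ℂ :=
  1 / 2 * laurentCoeff K (-n) * z ^ (-n : ℤ)
    + ∑ k ∈ Finset.Ioo (-n : ℤ) n, laurentCoeff K k * z ^ k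
    + 1 / 2 * laurentCoeff K n * z ^ n

/-- `K_n^+(z) = ½ c_n z^n + ∑_{k ≥ n+1} c_k z^k`. -/
def laurentPlus (K : ℂ → ℂ) (n : ℕ) (z : ℂ) : ℂ :=
  1 / 2 * laurentCoeff K n * z ^ n
    + ∑' j : ℕ, laurentCoeff K (n + 1 + j) * z ^ (n + 1 + j : ℤ)

/-- `K_n^-(z) = ∑_{k ≤ -n-1} c_k z^k + ½ c_{-n} z^{-n}`. -/
def laurentMinus (K : ℂ → ℂ) (n : ℕ) (z : ℂ) : ℂ :=
  ∑' j : ℕ, laurentCoeff K (-(n + 1 + j)) * z ^ (-(n + 1 + j) : ℤ)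
    + 1 / 2 * laurentCoeff K (-n) * z ^ (-n : ℤ)

/-- `z_-^n`, equal to `z^{-n}` for `|z| ≥ 1` and to `z^n` for `|z| < 1`. -/
def powMinus (n : ℕ) (z : ℂ) : ℂ := if 1 ≤ ‖z‖ then z ^ (-n : ℤ) else z ^ n

/-- `(z_-^n K(z) - z^{-n} K_n^+(z) - z^n K_n^-(z)) / (z^n - z^{-n})`. -/
def correctionKernel (K : ℂ → ℂ) (n : ℕ) (z : ℂ) : ℂ :=
  (powMinus n z * K z - z ^ (-n : ℤ) * laurentPlus K n z - z ^ n * laurentMinus K n z)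
    / (z ^ n - z ^ (-n : ℤ))

/-- `J` is the Cauchy principal value of `∫_a^b F(x) dx` with respect to the point `c`:
the integrals over `[a, c - ε]` and `[c + ε, b]` exist for small `ε > 0`, and their sum tends
to `J` as `ε → 0`. -/
def IsPrincipalValue (F : ℝ → ℂ) (a c b : ℝ) (J : ℂ) : Prop :=
  (∀ᶠ ε in 𝓝[>] (0 : ℝ), IntervalIntegrable F volume a (c - ε) ∧
      IntervalIntegrable F volume (c + ε) b) ∧
    Tendsto (fun ε : ℝ => (∫ x in a..(c - ε), F x) + ∫ x in (c + ε)..b, F x) (𝓝[>] 0) (𝓝 J)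

end ModifiedTrapezoid

end

namespace ModifiedTrapezoid

/-! ### Fourier series of continuous functions on `[0, 2π]` -/

/-! Write `w(t) = u(e^{it})` on `[0, 2π]`, completed by its one-sided end values `u₀`, `u₁`. The
error of the rule for `K_n u` is the sum over `|k| ≤ n` of the Laurent coefficients (halved at `k =
±n`) times the errors for `e^{ikt} w(t)`, so it suffices to know the latter uniformly in `|k| ≤ n`.

Rotating the contour into the sector at both ends gives `∫ e^{-imt} w = (u₁ - u₀) i/m + O(|m|^{-α})`
(`fourier_decay_of_sector`, `circleFun_decay`). The leading term is exactly that of the line through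
the end values. After subtracting the line, the remainder is periodic with Fourier coefficients
`O(|m|^{-α})`. Its error is a sum over the aliases `2nl - k`, `l ≠ 0`, all of modulus at least
`n|l|`, hence `O(n^{-α})` (`hasSum_trapErr`, `norm_trapErr_le`).

The line contributes the error of `t e^{ikt}`. Its Fourier series converges only conditionally, so
that error is computed in closed form and identified with an alias series through the partial
fractions of the cotangent (`trapErr_exp_mul_id`). The terms `1/(2n(j+1) - k) - 1/(2n(j+1) + k)` are
integrals over `[1, ∞)` of differences of powers of `y`. Summing under the integral sign yields
`monoKernel`, and stopping at `ρ` costs only `O(ρ^{|k| - 2n})` (`abs_integral_monoKernel_sub_le`).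
The Laurent coefficients decay like `q^{|k|}` with `qρ < 1`, so these defects add up to an
exponentially small quantity.

On the other side, folding `[ρ⁻¹, 1]` onto `[1, ρ]` by `x ↦ 1/x` turns the principal value into the
same sum of integrals of `monoKernel`, plus integrals of the Laurent tails
(`isPrincipalValue_of_fold`, `isPrincipalValue_correctionKernel`). The tails are `O(q^n)`, and so is
the change from `K` to `K_n` in the exact integral. -/

/-- The Fourier coefficient `(1/2π) ∫₀^{2π} g(t) e^{-imt} dt`. -/
noncomputable def fourierInt (g : ℝ → ℂ) (m : ℤ) : ℂ :=
  1 / (2 * Real.pi) * ∫ t in (0 : ℝ)..(2 * Real.pi), exp (-(m * t * I)) * g t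

/-- Equal end values make the periodic extension continuous on the circle, where summable
coefficients force pointwise convergence. -/
theorem hasSum_fourierInt {g : ℝ → ℂ} (hg : ContinuousOn g (Set.Icc 0 (2 * Real.pi)))
    (h0 : g 0 = g (2 * Real.pi)) (hs : Summable (fourierInt g)) {t : ℝ}
    (ht : t ∈ Set.Ico 0 (2 * Real.pi)) :
    HasSum (fun m : ℤ => fourierInt g m * exp (m * t * I)) (g t) := by
  have : Fact (0 < 2 * Real.pi) := ⟨Real.two_pi_pos⟩
  let F : C(AddCircle (2 * Real.pi), ℂ) :=
    ⟨AddCircle.liftIco (2 * Real.pi) 0 g, AddCircle.liftIco_zero_continuous h0 hg⟩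
  have hF : ∀ m, fourierCoeff F m = fourierInt g m := by
    intro m
    change fourierCoeff (AddCircle.liftIco (2 * Real.pi) 0 g) m = _
    rw [fourierCoeff_liftIco_eq, fourierCoeffOn_eq_integral, fourierInt]
    simp only [zero_add, sub_zero, real_smul]
    congr 1
    · push_cast; rfl
    · refine intervalIntegral.integral_congr fun x _ => ?_
      simp only [fourier_coe_apply, smul_eq_mul]
      congr 2
      have : (Real.pi : ℂ) ≠ 0 := by exact_mod_cast Real.pi_ne_zero
      push_cast
      field_simp
      ring
  have hs' : Summable (fourierCoeff F) := by simpa only [funext hF] using hs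
  have key := has_pointwise_sum_fourier_series_of_summable hs' (t : AddCircle (2 * Real.pi))
  have hFt : F (t : AddCircle (2 * Real.pi)) = g t := AddCircle.liftIco_zero_coe_apply ht
  rw [hFt] at key
  convert key using 2 with m
  rw [hF, smul_eq_mul, fourier_coe_apply]
  congr 2
  have : (Real.pi : ℂ) ≠ 0 := by exact_mod_cast Real.pi_ne_zero
  push_cast
  field_simp

/-! ### Laurent expansion in an annulus -/

theorem isCompact_annulus (r : ℝ) : IsCompact (annulus r) := by
  refine Metric.isCompact_of_isClosed_isBounded ?_ ?_
  · exact (isClosed_le continuous_const continuous_norm).inter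
      (isClosed_le continuous_norm continuous_const)
  · exact (Metric.isBounded_closedBall (x := (0 : ℂ)) (r := r)).subset
      fun z hz => by simpa using hz.2

theorem annulus_mono {r s : ℝ} (hr : 0 < r) (h : r ≤ s) : annulus r ⊆ annulus s :=
  fun _ hz => ⟨(inv_anti₀ hr h).trans hz.1, hz.2.trans h⟩

/-- An annulus `s⁻¹ ≤ |z| ≤ s` with `s > r` close to `r` lies in a given neighbourhood of
`r⁻¹ ≤ |z| ≤ r`. -/
theorem exists_annulus_subset {r : ℝ} (hr : 1 ≤ r) {U : Set ℂ} (hU : IsOpen U)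
    (h : annulus r ⊆ U) : ∃ s, r < s ∧ annulus s ⊆ U := by
  obtain ⟨δ, hδ, hsub⟩ := (isCompact_annulus r).exists_cthickening_subset_open hU h
  have hr0 : 0 < r := by linarith
  refine ⟨r + δ, by linarith, fun z hz => hsub ?_⟩
  have hz0 : 0 < ‖z‖ := lt_of_lt_of_le (by positivity) hz.1
  have hzne : (‖z‖ : ℂ) ≠ 0 := by exact_mod_cast hz0.ne'
  have aux : ∀ a : ℝ, 0 ≤ a → ‖(a : ℂ) / ‖z‖ * z‖ = a := fun a ha => by
    rw [norm_mul, norm_div, norm_real, norm_real, norm_norm, div_mul_cancel₀ _ hz0.ne',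
      Real.norm_of_nonneg ha]
  have aux2 : ∀ a : ℝ, dist z ((a : ℂ) / ‖z‖ * z) = |‖z‖ - a| := fun a => by
    have : z - (a : ℂ) / ‖z‖ * z = ((‖z‖ - a : ℝ) : ℂ) / ‖z‖ * z := by
      push_cast; field_simp
    rw [dist_eq, this, norm_mul, norm_div, norm_real, norm_real, norm_norm,
      div_mul_cancel₀ _ hz0.ne', Real.norm_eq_abs]
  have h1 : r⁻¹ ≤ r := (inv_le_one_of_one_le₀ hr).trans hr
  rcases lt_or_ge r ‖z‖ with h2 | h2
  · refine Metric.mem_cthickening_of_dist_le z ((r : ℂ) / ‖z‖ * z) δ _ ?_ ?_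
    · rw [annulus, Set.mem_ofPred_eq, aux r hr0.le]; exact ⟨h1, le_rfl⟩
    · rw [aux2, abs_of_pos (by linarith)]; linarith [hz.2]
  rcases lt_or_ge ‖z‖ r⁻¹ with h3 | h3
  · refine Metric.mem_cthickening_of_dist_le z (((r⁻¹ : ℝ) : ℂ) / ‖z‖ * z) δ _ ?_ ?_
    · rw [annulus, Set.mem_ofPred_eq, aux _ (by positivity)]; exact ⟨le_rfl, h1⟩
    · rw [aux2, abs_of_neg (by linarith)]
      -- The difference equals `δ / (r (r + δ))`, and the denominator is at least `1`.
      have h4 : r⁻¹ - (r + δ)⁻¹ ≤ δ := by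
        rw [inv_sub_inv hr0.ne' (by positivity), div_le_iff₀ (by positivity)]
        nlinarith [mul_le_mul hr hr zero_le_one hr0.le, mul_pos hr0 hδ]
      linarith [hz.1]
  · exact Metric.self_subset_cthickening _ ⟨h3, h2⟩

theorem exists_analyticOnNhd_annulus {K : ℂ → ℂ} {r : ℝ} (hr : 1 ≤ r)
    (hK : AnalyticOnNhd ℂ K (annulus r)) : ∃ s, r < s ∧ AnalyticOnNhd ℂ K (annulus s) :=
  exists_annulus_subset hr (isOpen_analyticAt ℂ K) hK

theorem annulus_one : annulus 1 = Metric.sphere 0 1 := by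
  ext z
  simp only [annulus, inv_one, Set.mem_ofPred_eq, mem_sphere_iff_norm, sub_zero]
  exact ⟨fun h => le_antisymm h.2 h.1, fun h => ⟨h.ge, h.le⟩⟩

theorem circleIntegral_eq_fourierInt (K : ℂ → ℂ) (m : ℤ) {s : ℝ} (hs : 0 < s) :
    (1 / (2 * Real.pi * I) * ∮ z in C(0, s), K z * z ^ (-m - 1)) * (s : ℂ) ^ m =
      fourierInt (fun t => K (s * exp (t * I))) m := by
  have hs' : (s : ℂ) ≠ 0 := by exact_mod_cast hs.ne'
  have hpi : (Real.pi : ℂ) ≠ 0 := by exact_mod_cast Real.pi_ne_zero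
  rw [fourierInt, circleIntegral, mul_assoc, mul_comm (∫ _ in _.._, _) ((s : ℂ) ^ m),
    ← intervalIntegral.integral_const_mul, ← intervalIntegral.integral_const_mul,
    ← intervalIntegral.integral_const_mul]
  refine intervalIntegral.integral_congr fun t _ => ?_
  simp only [deriv_circleMap, circleMap, zero_add, smul_eq_mul]
  have h1 : ((s : ℂ) * exp (t * I)) ^ (-m - 1) =
      (s : ℂ) ^ (-m) * (s : ℂ)⁻¹ * (exp (-(m * t * I)) * (exp (t * I))⁻¹) := by
    rw [mul_zpow, zpow_sub_one₀ hs', zpow_sub_one₀ (exp_ne_zero _), ← exp_int_mul]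
    congr 3
    push_cast; ring_nf
  rw [h1, zpow_neg]
  have := zpow_ne_zero m hs'
  have := exp_ne_zero (t * I)
  field_simp

/-- By Cauchy's theorem in the annulus the coefficient integral does not depend on the radius.
Laurent theory on `|z| = s` is thereby reduced to Fourier theory. -/
theorem laurentCoeff_mul_zpow {K : ℂ → ℂ} {r : ℝ} (hr : 1 ≤ r)
    (hK : AnalyticOnNhd ℂ K (annulus r)) (m : ℤ) {s : ℝ} (h1 : r⁻¹ ≤ s) (h2 : s ≤ r) :
    laurentCoeff K m * (s : ℂ) ^ m = fourierInt (fun t => K (s * exp (t * I))) m := by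
  have hs : 0 < s := lt_of_lt_of_le (by positivity) h1
  rw [← circleIntegral_eq_fourierInt K m hs, laurentCoeff]
  congr 2
  have key : ∀ a b : ℝ, 0 < a → a ≤ b → r⁻¹ ≤ a → b ≤ r →
      (∮ z in C(0, b), K z * z ^ (-m - 1)) = ∮ z in C(0, a), K z * z ^ (-m - 1) := by
    intro a b ha hab h1 h2
    have hd : ∀ z ∈ Metric.closedBall (0 : ℂ) b \ Metric.ball 0 a,
        DifferentiableAt ℂ (fun z => K z * z ^ (-m - 1)) z := by
      intro z hz
      simp only [Set.mem_sdiff, Metric.mem_closedBall, dist_zero_right, Metric.mem_ball,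
        not_lt] at hz
      have hz0 : z ≠ 0 := norm_pos_iff.1 (lt_of_lt_of_le ha hz.2)
      exact (hK z ⟨h1.trans hz.2, hz.1.trans h2⟩).differentiableAt.mul
        (differentiableAt_zpow.2 (Or.inl hz0))
    refine circleIntegral_eq_of_differentiable_on_annulus_off_countable ha hab
      Set.countable_empty (fun z hz => (hd z hz).continuousAt.continuousWithinAt) ?_
    rintro z ⟨⟨hz1, hz2⟩, -⟩
    refine hd z ⟨Metric.ball_subset_closedBall hz1, fun h => hz2 (Metric.ball_subset_closedBall h)⟩
  rcases le_total 1 s with h | h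
  · exact (key 1 s one_pos h (inv_le_one_of_one_le₀ hr) h2).symm
  · exact key s 1 hs h h1 hr

theorem norm_fourierInt_le {g : ℝ → ℂ} {C : ℝ} (hg : ∀ t, ‖g t‖ ≤ C) (m : ℤ) :
    ‖fourierInt g m‖ ≤ C := by
  have h := intervalIntegral.norm_integral_le_of_norm_le_const (a := 0) (b := 2 * Real.pi)
    (C := C) (f := fun t : ℝ => exp (-(m * t * I)) * g t) (fun t _ => by
      rw [norm_mul, show (-(m * t * I) : ℂ) = ((-(m * t) : ℝ) : ℂ) * I by push_cast; ring,
        norm_exp_ofReal_mul_I, one_mul]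
      exact hg t)
  have hpi := Real.two_pi_pos
  rw [fourierInt, norm_mul]
  have h2 : ‖(1 / (2 * Real.pi) : ℂ)‖ = 1 / (2 * Real.pi) := by
    rw [show (1 / (2 * Real.pi) : ℂ) = ((1 / (2 * Real.pi) : ℝ) : ℂ) by push_cast; rfl, norm_real,
      Real.norm_of_nonneg (by positivity)]
  rw [sub_zero, abs_of_pos hpi] at h
  rw [h2, div_mul_eq_mul_div, one_mul, div_le_iff₀ hpi]
  exact h

/-- Cauchy's estimate on the outer circle serves `m ≥ 0`, and on the inner circle `m ≤ 0`. -/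
theorem exists_norm_laurentCoeff_le {K : ℂ → ℂ} {r : ℝ} (hr : 1 ≤ r)
    (hK : AnalyticOnNhd ℂ K (annulus r)) :
    ∃ M, 0 ≤ M ∧ ∀ m : ℤ, ‖laurentCoeff K m‖ ≤ M * (r⁻¹) ^ m.natAbs := by
  have hr0 : 0 < r := by linarith
  obtain ⟨M, hM⟩ := (isCompact_annulus r).exists_bound_of_continuousOn hK.continuousOn
  have h1 : r⁻¹ ≤ r := (inv_le_one_of_one_le₀ hr).trans hr
  have key : ∀ s : ℝ, r⁻¹ ≤ s → s ≤ r → ∀ m : ℤ, ‖laurentCoeff K m‖ * s ^ m ≤ M := by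
    intro s hs1 hs2 m
    have hs : 0 < s := lt_of_lt_of_le (by positivity) hs1
    have h := congrArg norm (laurentCoeff_mul_zpow hr hK m hs1 hs2)
    rw [norm_mul, norm_zpow, norm_real, Real.norm_of_nonneg hs.le] at h
    rw [h]
    refine norm_fourierInt_le (fun t => hM _ ?_) m
    have : ‖(s : ℂ) * exp (t * I)‖ = s := by
      rw [norm_mul, norm_exp_ofReal_mul_I, norm_real, Real.norm_of_nonneg hs.le, mul_one]
    exact ⟨this.ge.trans' hs1, this.le.trans hs2⟩
  have hM0 : 0 ≤ M := (by positivity : (0 : ℝ) ≤ _).trans (key r h1 le_rfl 0)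
  refine ⟨M, hM0, fun m => ?_⟩
  rw [inv_pow, ← div_eq_mul_inv, le_div_iff₀ (by positivity)]
  rcases Int.natAbs_eq m with h | h
  · have h2 : r ^ m = r ^ m.natAbs := by conv_lhs => rw [h, zpow_natCast]
    exact h2 ▸ key r h1 le_rfl m
  · have h2 : r⁻¹ ^ m = r ^ m.natAbs := by
      conv_lhs => rw [h, zpow_neg, inv_zpow, inv_inv, zpow_natCast]
    exact h2 ▸ key r⁻¹ le_rfl h1 m

theorem summable_pow_natAbs {q : ℝ} (h0 : 0 ≤ q) (h1 : q < 1) :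
    Summable fun m : ℤ => q ^ m.natAbs := by
  refine Summable.of_nat_of_neg ?_ ?_ <;> simpa using summable_geometric_of_lt_one h0 h1

/-- Laurent's theorem. -/
theorem hasSum_laurent {K : ℂ → ℂ} {r : ℝ} (hr : 1 ≤ r)
    (hK : AnalyticOnNhd ℂ K (annulus r)) {z : ℂ} (hz1 : r⁻¹ < ‖z‖) (hz2 : ‖z‖ < r) :
    HasSum (fun m : ℤ => laurentCoeff K m * z ^ m) (K z) := by
  have hr0 : 0 < r := by linarith
  set s := ‖z‖ with hs
  have hs0 : 0 < s := lt_of_le_of_lt (by positivity) hz1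
  have hcoef := fun m => laurentCoeff_mul_zpow hr hK m hz1.le hz2.le
  have hz' : ∀ t : ℝ, ‖(s : ℂ) * exp (t * I)‖ = s := fun t => by
    rw [norm_mul, norm_exp_ofReal_mul_I, norm_real, Real.norm_of_nonneg hs0.le, mul_one]
  have hcont : Continuous fun t : ℝ => K (s * exp (t * I)) := by
    refine hK.continuousOn.comp_continuous (by fun_prop) fun t => ?_
    exact ⟨hz1.le.trans (hz' t).ge, (hz' t).le.trans hz2.le⟩
  obtain ⟨M, hM0, hM⟩ := exists_norm_laurentCoeff_le hr hK
  have hsum : Summable (fourierInt fun t : ℝ => K (s * exp (t * I))) := by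
    have hA := summable_pow_natAbs (q := r⁻¹ * s) (by positivity)
      (by rw [inv_mul_lt_iff₀ hr0]; linarith)
    have hB := summable_pow_natAbs (q := r⁻¹ * s⁻¹) (by positivity)
      (by rw [← mul_inv]; exact inv_lt_one_of_one_lt₀ ((inv_lt_iff_one_lt_mul₀' hr0).1 hz1))
    refine Summable.of_norm_bounded ((hA.add hB).mul_left M) fun m => ?_
    rw [← hcoef m, norm_mul, norm_zpow, norm_real, Real.norm_of_nonneg hs0.le, mul_pow, mul_pow,
      ← mul_add, ← mul_assoc]
    refine mul_le_mul (hM m) ?_ (by positivity) (by positivity)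
    rcases Int.natAbs_eq m with h | h
    · conv_lhs => rw [h, zpow_natCast]
      exact le_add_of_nonneg_right (by positivity)
    · conv_lhs => rw [h, zpow_neg, zpow_natCast, ← inv_pow]
      exact le_add_of_nonneg_left (by positivity)
  have h2pi : (fun t : ℝ => K (s * exp (t * I))) 0 =
      (fun t : ℝ => K (s * exp (t * I))) (2 * Real.pi) := by
    simp [exp_two_pi_mul_I]
  -- The principal argument lies in `(-π, π]` and has to be moved into `[0, 2π)`.
  set t := toIcoMod Real.two_pi_pos 0 (arg z) with ht
  have htm : t ∈ Set.Ico 0 (2 * Real.pi) := by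
    have := toIcoMod_mem_Ico Real.two_pi_pos 0 (arg z)
    rwa [zero_add] at this
  have hexp : exp (t * I) = exp (arg z * I) := by
    have h3 := toIcoMod_add_toIcoDiv_zsmul Real.two_pi_pos 0 (arg z)
    rw [← ht] at h3
    rw [← h3]
    push_cast
    rw [zsmul_eq_mul, add_mul, exp_add,
      mul_assoc (_ : ℂ) (2 * _) I,
      exp_int_mul_two_pi_mul_I, mul_one]
  have hz : (s : ℂ) * exp (t * I) = z := by rw [hexp, hs, norm_mul_exp_arg_mul_I]
  have key := hasSum_fourierInt hcont.continuousOn h2pi hsum htm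
  rw [hz] at key
  convert key using 2 with m
  rw [← hcoef m, ← hz, mul_zpow, ← exp_int_mul]
  ring_nf

/-! ### Decay of Fourier coefficients by rotation of the contour -/

/-- Raise `y ≤ e^y` with `y = c (1 + x) / β` to the power `β`. -/
theorem exists_one_add_rpow_mul_exp_le {β c : ℝ} (hβ : 0 < β) (hc : 0 < c) :
    ∃ B, 0 ≤ B ∧ ∀ x : ℝ, 0 ≤ x → (1 + x) ^ β * Real.exp (-(c * x)) ≤ B := by
  refine ⟨(c / β) ^ (-β) * Real.exp c, by positivity, fun x hx => ?_⟩
  have h1 : c / β * (1 + x) ≤ Real.exp (c / β * (1 + x)) := by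
    linarith [Real.add_one_le_exp (c / β * (1 + x))]
  have h2 := Real.rpow_le_rpow (by positivity) h1 hβ.le
  rw [Real.mul_rpow (by positivity) (by positivity), ← Real.exp_mul] at h2
  have h3 : c / β * (1 + x) * β = c + c * x := by field_simp
  rw [h3, Real.exp_add] at h2
  rw [Real.rpow_neg (by positivity), Real.exp_neg, ← div_eq_mul_inv, inv_mul_eq_div,
    div_le_div_iff₀ (by positivity) (by positivity)]
  linarith

theorem exists_exp_neg_le_rpow {α c : ℝ} (hα : 0 < α) (hc : 0 < c) :
    ∃ B, 0 ≤ B ∧ ∀ x : ℝ, 0 < x → Real.exp (-(c * x)) ≤ B * x ^ (-α) := by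
  obtain ⟨B, hB0, hB⟩ := exists_one_add_rpow_mul_exp_le hα hc
  refine ⟨B, hB0, fun x hx => ?_⟩
  rw [Real.rpow_neg hx.le, ← div_eq_mul_inv, le_div_iff₀ (by positivity), mul_comm]
  refine le_trans ?_ (hB x hx.le)
  gcongr
  linarith

/-- Since `x⁻¹ + s = x⁻¹ (1 + xs)`, half of the exponential absorbs the factor `(1 + xs)^{α-1}` and
the other half integrates to `O(1/x)`. This is the estimate for a slanted side of the rotated
contour. -/
theorem exists_norm_integral_le_rpow {α c : ℝ} (hα : 1 < α) (hc : 0 < c) :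
    ∃ B, 0 ≤ B ∧ ∀ (h : ℝ → ℂ) (A σ x : ℝ), 0 ≤ A → 0 ≤ σ → 0 < x →
      (∀ s ∈ Set.Icc 0 σ, ‖h s‖ ≤ A * (x⁻¹ + s) ^ (α - 1) * Real.exp (-(c * (x * s)))) →
      ‖∫ s in (0 : ℝ)..σ, h s‖ ≤ A * B * x ^ (-α) := by
  obtain ⟨B, hB0, hB⟩ := exists_one_add_rpow_mul_exp_le (sub_pos.2 hα) (half_pos hc)
  refine ⟨B * (2 / c), by positivity, fun h A σ x hA hσ hx hh => ?_⟩
  have hb : ∀ s ∈ Set.Icc 0 σ, ‖h s‖ ≤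
      A * x ^ (-(α - 1)) * B * Real.exp (-(c / 2 * x) * s) := by
    intro s hs
    refine (hh s hs).trans ?_
    have hs0 := hs.1
    have e1 : x⁻¹ + s = x⁻¹ * (1 + x * s) := by field_simp
    have e2 : Real.exp (-(c * (x * s))) =
        Real.exp (-(c / 2 * (x * s))) * Real.exp (-(c / 2 * x) * s) := by
      rw [← Real.exp_add]; ring_nf
    rw [e1, Real.mul_rpow (by positivity) (by positivity), Real.inv_rpow hx.le,
      ← Real.rpow_neg hx.le, e2]
    have := hB (x * s) (by positivity)
    calc A * (x ^ (-(α - 1)) * (1 + x * s) ^ (α - 1)) *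
          (Real.exp (-(c / 2 * (x * s))) * Real.exp (-(c / 2 * x) * s))
        = A * x ^ (-(α - 1)) * ((1 + x * s) ^ (α - 1) * Real.exp (-(c / 2 * (x * s)))) *
          Real.exp (-(c / 2 * x) * s) := by ring
      _ ≤ _ := by gcongr
  have hcx : -(c / 2 * x) ≠ 0 := by have := mul_pos hc hx; linarith
  calc ‖∫ s in (0 : ℝ)..σ, h s‖
      ≤ ∫ s in (0 : ℝ)..σ, A * x ^ (-(α - 1)) * B * Real.exp (-(c / 2 * x) * s) := by
        refine intervalIntegral.norm_integral_le_of_norm_le hσ ?_ ?_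
        · exact ae_of_all _ fun s hs => hb s ⟨hs.1.le, hs.2⟩
        · exact Continuous.intervalIntegrable (by fun_prop) _ _
    _ = A * x ^ (-(α - 1)) * B * ((Real.exp (-(c / 2 * x) * σ) - 1) / (-(c / 2 * x))) := by
        rw [intervalIntegral.integral_const_mul, intervalIntegral.integral_comp_mul_left
          (fun s => Real.exp s) hcx, integral_exp]
        simp only [mul_zero, Real.exp_zero, smul_eq_mul]
        field_simp
    _ ≤ A * x ^ (-(α - 1)) * B * (2 / (c * x)) := by
        refine mul_le_mul_of_nonneg_left ?_ (by positivity)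
        rw [div_neg, ← neg_div, neg_sub, div_le_div_iff₀ (by positivity) (by positivity)]
        have := Real.exp_pos (-(c / 2 * x) * σ)
        have := mul_pos hc hx
        nlinarith
    _ = A * (B * (2 / c)) * x ^ (-α) := by
        have : x ^ (-α) = x ^ (-(α - 1)) * x⁻¹ := by
          rw [← Real.rpow_neg_one, ← Real.rpow_add hx]; ring_nf
        rw [this]
        field_simp

/-- The integral of a function along a segment is the difference of the values of a primitive. -/
theorem integral_segment {g G : ℂ → ℂ} {U : Set ℂ} (hG : ∀ z ∈ U, HasDerivAt G (g z) z)
    (hg : ContinuousOn g U) {z v : ℂ} {σ : ℝ} (hσ : 0 ≤ σ)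
    (h : ∀ s ∈ Set.Icc 0 σ, z + (s : ℂ) * v ∈ U) :
    ∫ s in (0 : ℝ)..σ, g (z + s * v) * v = G (z + σ * v) - G z := by
  have key := intervalIntegral.integral_eq_sub_of_hasDerivAt
    (f := fun s : ℝ => G (z + s * v)) (f' := fun s : ℝ => g (z + s * v) * v) (a := 0) (b := σ) ?_ ?_
  · simpa using key
  · intro s hs
    rw [Set.uIcc_of_le hσ] at hs
    have h1 : HasDerivAt (fun s : ℝ => z + (s : ℂ) * v) v s := by
      simpa using (((hasDerivAt_id s).ofReal_comp).mul_const v).const_add z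
    exact (hG _ (h s hs)).comp s h1
  · refine ContinuousOn.intervalIntegrable ?_
    rw [Set.uIcc_of_le hσ]
    exact (hg.comp (by fun_prop) h).mul continuousOn_const

/-- The open rectangle `0 < Re t < 2π`, `|Im t| < L`. -/
def openRect (L : ℝ) : Set ℂ := Set.Ioo 0 (2 * Real.pi) ×ℂ Set.Ioo (-L) L

theorem isOpen_openRect (L : ℝ) : IsOpen (openRect L) := isOpen_Ioo.reProdIm isOpen_Ioo

theorem convex_openRect (L : ℝ) : Convex ℝ (openRect L) := by
  have h1 := (convex_Ioo 0 (2 * Real.pi)).linear_preimage reLm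
  have h2 := (convex_Ioo (-L) L).linear_preimage imLm
  exact h1.inter h2

theorem norm_exp_neg_nat_mul (m : ℕ) (t : ℂ) : ‖exp (-(m * t * I))‖ = Real.exp (m * t.im) := by
  rw [norm_exp]; simp

theorem hasDerivAt_exp_primitive {m : ℕ} (hm : m ≠ 0) (t : ℂ) :
    HasDerivAt (fun t : ℂ => exp (-(m * t * I)) * (I / m)) (exp (-(m * t * I))) t := by
  have hm' : (m : ℂ) ≠ 0 := by exact_mod_cast hm
  have h1 : HasDerivAt (fun t : ℂ => -((m : ℂ) * t * I)) (-((m : ℂ) * I)) t := by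
    refine (((hasDerivAt_id' t).const_mul (m : ℂ)).mul_const I).fun_neg.congr_deriv ?_
    rw [mul_one]
  refine (h1.cexp.mul_const (I / m)).congr_deriv ?_
  field_simp
  linear_combination -I_sq

-- For positive frequency `e^{-imt}` decays in the lower half plane. The segment `[0, 2π]` is
-- deformed so as to run along the axis from `0` to `1/m`, down a ray inside the sector, across at
-- fixed depth, and symmetrically back up. The end pieces and the slanted sides give `O(m^{-α})`
-- once `a` or `b` is subtracted, the bottom is exponentially small, and the subtracted constants
-- integrate to the main term `(b - a) i/m`.
set_option maxHeartbeats 2000000 in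
theorem fourier_decay_of_sector {f : ℂ → ℂ} {a b : ℂ} {L κ α C δ : ℝ} (hα : 1 < α) (hκ : 0 < κ)
    (hL : 0 < L) (hδ : 0 < δ) (hC : 0 ≤ C) (hf : DifferentiableOn ℂ f (openRect L))
    (hint : IntervalIntegrable (fun t : ℝ => f t) volume 0 (2 * Real.pi))
    (ha : ∀ t ∈ sector κ, ‖t‖ ≤ δ → ‖f t - a‖ ≤ C * ‖t‖ ^ (α - 1))
    (hb : ∀ t ∈ sector κ, ‖t‖ ≤ δ → ‖f (2 * Real.pi - t) - b‖ ≤ C * ‖t‖ ^ (α - 1)) :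
    ∃ C', 0 ≤ C' ∧ ∀ᶠ m : ℕ in atTop,
      ‖(∫ t in (0 : ℝ)..(2 * Real.pi), exp (-(m * t * I)) * f t) - (b - a) * (I / m)‖
        ≤ C' * (m : ℝ) ^ (-α) := by
  -- Half the opening keeps the slanted sides strictly inside the open sector.
  set k := κ / 2 with hk
  have hk0 : 0 < k := half_pos hκ
  have hpi := Real.pi_gt_three
  -- `σ` is the horizontal extent of a slanted side. The bound `1` leaves room between the two
  -- sides, `δ / 2` keeps the side where the end estimates hold, and `L` keeps it in the rectangle
  -- of analyticity.
  obtain ⟨σ, hσ0, hσ1, hσδ, hσL⟩ : ∃ σ : ℝ, 0 < σ ∧ σ ≤ 1 ∧ σ * (1 + k) ≤ δ / 2 ∧ σ * k < L := by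
    refine ⟨min 1 (min (δ / 2 / (1 + k)) (L / 2 / k)), by positivity, min_le_left _ _, ?_, ?_⟩
    · rw [← le_div_iff₀ (by positivity)]
      exact (min_le_right _ _).trans (min_le_left _ _)
    · rw [← lt_div_iff₀ hk0]
      refine ((min_le_right _ _).trans (min_le_right _ _)).trans_lt ?_
      gcongr
      linarith
  obtain ⟨M, hM⟩ : ∃ M, ∀ x ∈ Set.Icc σ (2 * Real.pi - σ), ‖f (x - σ * k * I)‖ ≤ M := by
    refine isCompact_Icc.exists_bound_of_continuousOn ?_
    refine hf.continuousOn.comp (by fun_prop) fun x hx => ?_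
    refine ⟨?_, ?_⟩
    · simp only [Set.mem_preimage, sub_re, ofReal_re, mul_re, I_re, mul_zero, ofReal_im, I_im,
        mul_one, sub_zero, Set.mem_Ioo, mul_im, zero_mul, add_zero]
      constructor <;> linarith [hx.1, hx.2]
    · simp only [Set.mem_preimage, sub_im, ofReal_im, mul_im, mul_re, ofReal_re, I_im, mul_one,
        zero_mul, sub_zero, mul_zero, add_zero, I_re, zero_sub, Set.mem_Ioo]
      constructor <;> nlinarith
  have hM0 : 0 ≤ M := (norm_nonneg _).trans (hM σ ⟨le_rfl, by linarith⟩)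
  obtain ⟨B, hB0, hB⟩ := exists_norm_integral_le_rpow hα hk0
  obtain ⟨B', hB'0, hB'⟩ := exists_exp_neg_le_rpow (α := α) (by linarith) (mul_pos hk0 hσ0)
  set A := C * (1 + k) ^ (α - 1) * (1 + k) with hA
  have hA0 : 0 ≤ A := by positivity
  refine ⟨C + C + A * B + A * B + M * B' * (2 * Real.pi) + ‖a‖ * B' + ‖b‖ * B', by positivity, ?_⟩
  have hev : ∀ᶠ m : ℕ in atTop, (m : ℝ)⁻¹ ≤ min 1 (δ / 2) :=
    tendsto_inv_atTop_nhds_zero_nat.eventually_le_const (by positivity)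
  filter_upwards [hev, eventually_ge_atTop 1] with m hmε hm1
  have hm0 : m ≠ 0 := by omega
  have hm : (0 : ℝ) < m := by exact_mod_cast hm1
  -- Nothing is known about `f` off the real axis outside the open rectangle or the sectors, so the
  -- contour leaves the axis at distance `1/m` from the ends; there `ε^{α-1} · ε = m^{-α}`.
  set ε : ℝ := (m : ℝ)⁻¹ with hε
  have hε0 : 0 < ε := by positivity
  have hε1 : ε ≤ 1 := hmε.trans (min_le_left _ _)
  have hεδ : ε ≤ δ / 2 := hmε.trans (min_le_right _ _)
  set e : ℂ → ℂ := fun t => exp (-(m * t * I)) with he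
  set E : ℂ → ℂ := fun t => exp (-(m * t * I)) * (I / m) with hE
  have hdE : ∀ t, HasDerivAt E (e t) t := hasDerivAt_exp_primitive hm0
  have hce : Continuous e := by fun_prop
  have hef : DifferentiableOn ℂ (fun t => e t * f t) (openRect L) :=
    (show Differentiable ℂ e by fun_prop).differentiableOn.mul hf
  -- A primitive on the convex rectangle replaces Cauchy's theorem: every side of the contour
  -- becomes a difference of values of `G`.
  obtain ⟨G, hG'⟩ := (convex_openRect L).exists_forall_hasDerivWithinAt hef
  have hG : ∀ z ∈ openRect L, HasDerivAt G (e z * f z) z := fun z hz =>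
    (hG' z hz).hasDerivAt ((isOpen_openRect L).mem_nhds hz)
  have hGc : ∀ c : ℂ, ∀ z ∈ openRect L,
      HasDerivAt (fun z => G z - E z * c) (e z * (f z - c)) z := fun c z hz => by
    refine ((hG z hz).fun_sub ((hdE z).mul_const c)).congr_deriv ?_
    ring
  have hcc : ∀ c : ℂ, ContinuousOn (fun z => e z * (f z - c)) (openRect L) := fun c =>
    hce.continuousOn.mul (hf.continuousOn.sub continuousOn_const)
  have hmem : ∀ (z : ℂ), 0 < z.re → z.re < 2 * Real.pi → -(σ * k) ≤ z.im → z.im ≤ 0 →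
      z ∈ openRect L := fun z h1 h2 h3 h4 => ⟨⟨h1, h2⟩, ⟨by linarith, by linarith⟩⟩
  -- the three inner pieces of the contour
  have hS1 := integral_segment (hGc a) (hcc a) (z := (ε : ℂ)) (v := 1 - k * I) hσ0.le (by
    intro s hs
    have := hs.1; have := hs.2
    apply hmem <;> simp <;> nlinarith)
  have hS3 := integral_segment (hGc b) (hcc b) (z := 2 * Real.pi - (ε : ℂ)) (v := -(1 + k * I))
    hσ0.le (by
    intro s hs
    have := hs.1; have := hs.2
    apply hmem <;> simp <;> nlinarith)
  have hS2 := integral_segment hG hef.continuousOn (z := (ε : ℂ) + σ * (1 - k * I)) (v := 1)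
    (σ := 2 * Real.pi - 2 * ε - 2 * σ) (by linarith) (by
    intro s hs
    have := hs.1; have := hs.2
    apply hmem <;> simp <;> nlinarith)
  have hS0 := integral_segment hG hef.continuousOn (z := (ε : ℂ)) (v := 1)
    (σ := 2 * Real.pi - 2 * ε) (by linarith) (by
    intro s hs
    have := hs.1; have := hs.2
    apply hmem <;> simp <;> nlinarith)
  have hBC : (ε : ℂ) + σ * (1 - k * I) + ((2 * Real.pi - 2 * ε - 2 * σ : ℝ) : ℂ) * 1 =
      2 * Real.pi - ε + σ * (-(1 + k * I)) := by push_cast; ring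
  have hD : (ε : ℂ) + ((2 * Real.pi - 2 * ε : ℝ) : ℂ) * 1 = 2 * Real.pi - ε := by push_cast; ring
  rw [hBC] at hS2
  rw [hD] at hS0
  -- the two ends
  have hintc : ∀ c : ℂ, IntervalIntegrable (fun t : ℝ => e t * (f t - c)) volume 0 (2 * Real.pi) :=
    fun c => (hint.sub intervalIntegrable_const).continuousOn_mul
      (hce.comp continuous_ofReal).continuousOn
  have hinte : IntervalIntegrable (fun t : ℝ => e t * f t) volume 0 (2 * Real.pi) :=
    hint.continuousOn_mul (hce.comp continuous_ofReal).continuousOn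
  have hsub : ∀ {x y : ℝ}, 0 ≤ x → x ≤ y → y ≤ 2 * Real.pi →
      Set.uIcc x y ⊆ Set.uIcc 0 (2 * Real.pi) := fun h1 h2 h3 => by
    rw [Set.uIcc_of_le h2, Set.uIcc_of_le (by linarith)]; exact Set.Icc_subset_Icc h1 h3
  have hEint : ∀ x y : ℝ, ∫ t in x..y, e t = E y - E x := fun x y =>
    intervalIntegral.integral_eq_sub_of_hasDerivAt (fun t _ => (hdE t).comp_ofReal)
      ((hce.comp continuous_ofReal).intervalIntegrable _ _)
  have hend : ∀ (c : ℂ) {x y : ℝ}, 0 ≤ x → x ≤ y → y ≤ 2 * Real.pi →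
      ∫ t in x..y, e t * f t = (∫ t in x..y, e t * (f t - c)) + (E y - E x) * c := by
    intro c x y h1 h2 h3
    rw [← hEint, ← intervalIntegral.integral_mul_const, ← intervalIntegral.integral_add
      ((hintc c).mono_set (hsub h1 h2 h3))
      (Continuous.intervalIntegrable (by fun_prop) _ _)]
    refine intervalIntegral.integral_congr fun t _ => ?_
    ring
  have hsplit : ∫ t in (0 : ℝ)..(2 * Real.pi), e t * f t =
      (∫ t in (0 : ℝ)..ε, e t * f t) + (∫ t in ε..(2 * Real.pi - ε), e t * f t) +
        ∫ t in (2 * Real.pi - ε)..(2 * Real.pi), e t * f t := by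
    rw [intervalIntegral.integral_add_adjacent_intervals,
      intervalIntegral.integral_add_adjacent_intervals] <;>
    exact hinte.mono_set (hsub (by linarith) (by linarith) (by linarith))
  have hmid : ∫ t in ε..(2 * Real.pi - ε), e t * f t =
      ∫ s in (0 : ℝ)..(2 * Real.pi - 2 * ε), e (ε + s * 1) * f (ε + s * 1) * 1 := by
    have := intervalIntegral.integral_comp_add_left (a := 0) (b := 2 * Real.pi - 2 * ε)
      (fun t : ℝ => e t * f t) ε
    rw [add_zero, show ε + (2 * Real.pi - 2 * ε) = 2 * Real.pi - ε by ring] at this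
    rw [← this]
    simp
  have hE0 : E ((0 : ℝ) : ℂ) = I / m := by simp [E]
  have hE2 : E ((2 * Real.pi : ℝ) : ℂ) = I / m := by
    have : exp (-(m * ((2 * Real.pi : ℝ) : ℂ) * I)) = 1 := by
      rw [exp_neg, show (m : ℂ) * ((2 * Real.pi : ℝ) : ℂ) * I = (m : ℤ) * (2 * Real.pi * I) by
        push_cast; ring, exp_int_mul_two_pi_mul_I, inv_one]
    simp only [E, this, one_mul]
  have hcast : ((2 * Real.pi - ε : ℝ) : ℂ) = 2 * Real.pi - ε := by push_cast; rfl
  set R1 := ∫ t in (0 : ℝ)..ε, e t * (f t - a) with hR1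
  set R3 := ∫ t in (2 * Real.pi - ε)..(2 * Real.pi), e t * (f t - b) with hR3
  -- All values of `G` telescope. Of the primitive `E` of the exponential, the values at `0` and
  -- `2π` form the main term, those at `ε` and `2π - ε` cancel, and those at depth `σk` remain.
  have htotal : (∫ t in (0 : ℝ)..(2 * Real.pi), e t * f t) - (b - a) * (I / m) =
      R1 + R3 + (∫ s in (0 : ℝ)..σ, e (ε + s * (1 - k * I)) * (f (ε + s * (1 - k * I)) - a) *
        (1 - k * I)) - (∫ s in (0 : ℝ)..σ, e (2 * Real.pi - ε + s * (-(1 + k * I))) *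
          (f (2 * Real.pi - ε + s * (-(1 + k * I))) - b) * (-(1 + k * I)))
      + (∫ s in (0 : ℝ)..(2 * Real.pi - 2 * ε - 2 * σ), e (ε + σ * (1 - k * I) + s * 1) *
        f (ε + σ * (1 - k * I) + s * 1) * 1)
      + E (ε + σ * (1 - k * I)) * a - E (2 * Real.pi - ε + σ * (-(1 + k * I))) * b := by
    rw [hsplit, hmid, hend a le_rfl hε0.le (by linarith),
      hend b (by linarith) (by linarith) le_rfl, hS0, hS1, hS2, hS3, hE0, hE2, hcast]
    ring
  have hpow : ε ^ (α - 1) * ε = (m : ℝ) ^ (-α) := by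
    rw [← Real.rpow_add_one hε0.ne', sub_add_cancel, hε, Real.inv_rpow hm.le, Real.rpow_neg hm.le]
  have hsec : ∀ (s : ℝ), 0 < s → (s : ℂ) ∈ sector κ := fun s hs => by
    simp only [sector, Set.mem_ofPred_eq, ofReal_im, abs_zero, ofReal_re]; positivity
  have hen : ∀ t : ℝ, ‖e t‖ = 1 := fun t => by simp [e, norm_exp_neg_nat_mul]
  have bR1 : ‖R1‖ ≤ C * (m : ℝ) ^ (-α) := by
    have := intervalIntegral.norm_integral_le_of_norm_le_const (a := 0) (b := ε)
      (C := C * ε ^ (α - 1)) (f := fun t : ℝ => e t * (f t - a)) (fun t ht => by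
        rw [Set.uIoc_of_le hε0.le] at ht
        have hn : ‖(t : ℂ)‖ = t := by rw [norm_real, Real.norm_of_nonneg ht.1.le]
        rw [norm_mul, hen, one_mul]
        refine (ha t (hsec t ht.1) (by linarith [ht.2])).trans ?_
        rw [hn]
        have := ht.1.le
        gcongr
        exact ht.2)
    rwa [sub_zero, abs_of_pos hε0, mul_assoc, hpow] at this
  have bR3 : ‖R3‖ ≤ C * (m : ℝ) ^ (-α) := by
    have := intervalIntegral.norm_integral_le_of_norm_le_const_ae (a := 2 * Real.pi - ε)
      (b := 2 * Real.pi)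
      (C := C * ε ^ (α - 1)) (f := fun t : ℝ => e t * (f t - b)) (by
        -- The vertex is not in the open sector, so `f (2π)` is unconstrained and the endpoint has
        -- to be discarded as a null set. At the other end the half-open interval already omits `0`.
        filter_upwards [compl_mem_ae_iff.2 (measure_singleton (2 * Real.pi : ℝ))] with t htne ht
        rw [Set.uIoc_of_le (by linarith)] at ht
        have ht2 : t < 2 * Real.pi := lt_of_le_of_ne ht.2 htne
        have hn : ‖((2 * Real.pi - t : ℝ) : ℂ)‖ = 2 * Real.pi - t := by
          rw [norm_real, Real.norm_of_nonneg (by linarith)]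
        rw [norm_mul, hen, one_mul]
        have h1 := hb _ (hsec (2 * Real.pi - t) (by linarith)) (by linarith [ht.1])
        rw [hn] at h1
        push_cast at h1
        rw [sub_sub_cancel] at h1
        refine h1.trans ?_
        gcongr
        linarith [ht.1])
    rwa [sub_sub_cancel, abs_of_pos hε0, mul_assoc, hpow] at this
  have hdir : ∀ (s : ℝ) (d : ℂ), 0 ≤ s → s ≤ σ → d.re = 1 → |d.im| = k →
      (ε + s * d : ℂ) ∈ sector κ ∧ ‖(ε + s * d : ℂ)‖ ≤ (1 + k) * (ε + s) ∧
        ‖(ε + s * d : ℂ)‖ ≤ δ ∧ ‖d‖ ≤ 1 + k := by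
    intro s d hs0 hs1 hd1 hd2
    have hdn : ‖d‖ ≤ 1 + k := by
      refine (norm_le_abs_re_add_abs_im d).trans ?_
      rw [hd1, hd2, abs_one]
    have hn : ‖(ε + s * d : ℂ)‖ ≤ ε + s * (1 + k) := by
      refine (norm_add_le _ _).trans ?_
      rw [norm_mul, norm_real, norm_real, Real.norm_of_nonneg hε0.le, Real.norm_of_nonneg hs0]
      gcongr
    refine ⟨?_, hn.trans (by nlinarith), hn.trans (by nlinarith), hdn⟩
    simp only [sector, Set.mem_ofPred_eq, add_im, ofReal_im, mul_im, ofReal_re, zero_mul, add_zero,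
      zero_add, add_re, mul_re, sub_zero, hd1, mul_one, abs_mul, hd2, abs_of_nonneg hs0]
    nlinarith
  have bslant : ∀ (s : ℝ) (y z d c : ℂ), s ∈ Set.Icc 0 σ → d.re = 1 → |d.im| = k →
      z.im = -(s * k) → ‖f z - c‖ ≤ C * ‖(ε + s * d : ℂ)‖ ^ (α - 1) → ‖y‖ = ‖d‖ →
      ‖e z * (f z - c) * y‖ ≤ A * (ε + s) ^ (α - 1) * Real.exp (-(k * (m * s))) := by
    intro s y z d c hs h1 h2 h3 h4 h5
    obtain ⟨-, h6, -, h7⟩ := hdir s d hs.1 hs.2 h1 h2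
    have hεs : 0 ≤ ε + s := add_nonneg hε0.le hs.1
    have h8 : ‖f z - c‖ ≤ C * ((1 + k) ^ (α - 1) * (ε + s) ^ (α - 1)) := by
      refine h4.trans ?_
      rw [← Real.mul_rpow (by positivity) hεs]
      gcongr
    rw [norm_mul, norm_mul, h5, he]
    simp only
    rw [norm_exp_neg_nat_mul, h3, show (m : ℝ) * -(s * k) = -(k * (m * s)) by ring]
    calc _ ≤ Real.exp (-(k * (m * s))) * (C * ((1 + k) ^ (α - 1) * (ε + s) ^ (α - 1))) *
          (1 + k) := by gcongr
      _ = _ := by rw [hA]; ring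
  have bS1 : ‖∫ s in (0 : ℝ)..σ, e (ε + s * (1 - k * I)) * (f (ε + s * (1 - k * I)) - a) *
        (1 - k * I)‖ ≤ A * B * (m : ℝ) ^ (-α) := by
    refine hB _ A σ m hA0 hσ0.le hm fun s hs => ?_
    have hd1 : ((1 : ℂ) - k * I).re = 1 := by simp
    have hd2 : |((1 : ℂ) - k * I).im| = k := by simp [abs_of_pos hk0]
    obtain ⟨h5, -, h6, -⟩ := hdir s _ hs.1 hs.2 hd1 hd2
    exact bslant s _ _ _ a hs hd1 hd2 (by simp) (ha _ h5 h6) rfl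
  have bS3 : ‖∫ s in (0 : ℝ)..σ, e (2 * Real.pi - ε + s * (-(1 + k * I))) *
          (f (2 * Real.pi - ε + s * (-(1 + k * I))) - b) * (-(1 + k * I))‖
        ≤ A * B * (m : ℝ) ^ (-α) := by
    refine hB _ A σ m hA0 hσ0.le hm fun s hs => ?_
    have hd1 : ((1 : ℂ) + k * I).re = 1 := by simp
    have hd2 : |((1 : ℂ) + k * I).im| = k := by simp [abs_of_pos hk0]
    obtain ⟨h5, -, h6, -⟩ := hdir s _ hs.1 hs.2 hd1 hd2
    refine bslant s _ _ _ b hs hd1 hd2 (by simp) ?_ (norm_neg _)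
    convert hb _ h5 h6 using 4
    ring
  have hexp : Real.exp (m * -(σ * k)) ≤ B' * (m : ℝ) ^ (-α) := by
    have := hB' m hm
    rwa [show -(k * σ * (m : ℝ)) = m * -(σ * k) by ring] at this
  have bS2 : ‖∫ s in (0 : ℝ)..(2 * Real.pi - 2 * ε - 2 * σ), e (ε + σ * (1 - k * I) + s * 1) *
        f (ε + σ * (1 - k * I) + s * 1) * 1‖ ≤ M * B' * (2 * Real.pi) * (m : ℝ) ^ (-α) := by
    have hlen : 0 ≤ 2 * Real.pi - 2 * ε - 2 * σ := by linarith
    have := intervalIntegral.norm_integral_le_of_norm_le_const (a := 0)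
      (b := 2 * Real.pi - 2 * ε - 2 * σ) (C := B' * (m : ℝ) ^ (-α) * M)
      (f := fun s : ℝ => e (ε + σ * (1 - k * I) + s * 1) * f (ε + σ * (1 - k * I) + s * 1) * 1)
      (fun s hs => by
        rw [Set.uIoc_of_le hlen] at hs
        rw [mul_one, norm_mul]
        refine mul_le_mul ?_ ?_ (norm_nonneg _) (by positivity)
        · simp only [e]
          rw [norm_exp_neg_nat_mul]
          simpa using hexp
        · have := hM (ε + σ + s) ⟨by linarith [hs.1], by linarith [hs.2]⟩
          rwa [show (((ε + σ + s : ℝ) : ℂ) - σ * k * I) = ε + σ * (1 - k * I) + s * 1 by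
            push_cast; ring] at this)
    refine this.trans ?_
    rw [sub_zero, abs_of_nonneg hlen]
    calc _ ≤ B' * (m : ℝ) ^ (-α) * M * (2 * Real.pi) := by gcongr; linarith
      _ = _ := by ring
  have hEn : ∀ z c : ℂ, z.im = -(σ * k) → ‖E z * c‖ ≤ ‖c‖ * B' * (m : ℝ) ^ (-α) := by
    intro z c hz
    have h1 : ‖I / (m : ℂ)‖ ≤ 1 := by
      rw [norm_div, norm_I, Complex.norm_natCast, one_div]; exact hε1
    rw [hE]
    simp only
    rw [norm_mul, norm_mul, norm_exp_neg_nat_mul, hz]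
    calc _ ≤ B' * (m : ℝ) ^ (-α) * 1 * ‖c‖ := by gcongr
      _ = _ := by ring
  have bEa := hEn (ε + σ * (1 - k * I)) a (by simp)
  have bEb := hEn (2 * Real.pi - ε + σ * (-(1 + k * I))) b (by simp)
  rw [htotal]
  have h3 : ∀ x1 x2 x3 x4 x5 x6 x7 : ℂ, ‖x1 + x2 + x3 - x4 + x5 + x6 - x7‖ ≤
      ‖x1‖ + ‖x2‖ + ‖x3‖ + ‖x4‖ + ‖x5‖ + ‖x6‖ + ‖x7‖ := fun x1 x2 x3 x4 x5 x6 x7 =>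
    (norm_sub_le _ _).trans (add_le_add_left ((norm_add_le _ _).trans (add_le_add_left
      ((norm_add_le _ _).trans (add_le_add_left ((norm_sub_le _ _).trans
        (add_le_add_left norm_add₃_le _)) _)) _)) _)
  refine (h3 _ _ _ _ _ _ _).trans ?_
  calc _ ≤ _ := add_le_add (add_le_add (add_le_add (add_le_add (add_le_add (add_le_add bR1 bR3)
        bS1) bS3) bS2) bEa) bEb
    _ = _ := by ring

/-! ### Aliasing for the trapezoidal rule with `2n` subintervals -/

/-- The trapezoidal sum with `2n` subintervals of a function on `[0, 2π]`. -/
noncomputable def trapSum (n : ℕ) (g : ℝ → ℂ) : ℂ :=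
  Real.pi / n * (g 0 / 2 + ∑ j ∈ Finset.Ico 1 (2 * n), g (Real.pi * j / n) + g (2 * Real.pi) / 2)

/-- The error of the trapezoidal rule with `2n` subintervals on `[0, 2π]`. -/
noncomputable def trapErr (n : ℕ) (g : ℝ → ℂ) : ℂ :=
  trapSum n g - ∫ t in (0 : ℝ)..(2 * Real.pi), g t

theorem trapErr_add {n : ℕ} {g h : ℝ → ℂ}
    (hg : IntervalIntegrable g volume 0 (2 * Real.pi))
    (hh : IntervalIntegrable h volume 0 (2 * Real.pi)) :
    trapErr n (fun t => g t + h t) = trapErr n g + trapErr n h := by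
  rw [trapErr, trapErr, trapErr, intervalIntegral.integral_add hg hh, trapSum, trapSum, trapSum,
    Finset.sum_add_distrib]
  ring

theorem trapErr_const_mul (n : ℕ) (c : ℂ) (g : ℝ → ℂ) :
    trapErr n (fun t => c * g t) = c * trapErr n g := by
  rw [trapErr, trapErr, intervalIntegral.integral_const_mul, trapSum, trapSum, ← Finset.mul_sum]
  ring

theorem trapErr_sum {ι : Type*} {n : ℕ} (s : Finset ι) {g : ι → ℝ → ℂ}
    (hg : ∀ i ∈ s, IntervalIntegrable (g i) volume 0 (2 * Real.pi)) :
    trapErr n (fun t => ∑ i ∈ s, g i t) = ∑ i ∈ s, trapErr n (g i) := by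
  simp only [trapErr, trapSum]
  rw [intervalIntegral.integral_finsetSum hg, Finset.sum_sub_distrib, ← Finset.mul_sum,
    Finset.sum_add_distrib, Finset.sum_add_distrib, Finset.sum_comm, Finset.sum_div,
    Finset.sum_div]

theorem exp_int_mul_grid (n : ℕ) (k : ℤ) (j : ℕ) :
    exp (k * ((Real.pi * j / n : ℝ) : ℂ) * I) = exp (k * (Real.pi / n) * I) ^ j := by
  rw [← exp_nat_mul]
  congr 1
  push_cast
  ring

theorem exp_grid_pow {n : ℕ} (hn : 1 ≤ n) (k : ℤ) :
    exp (k * (Real.pi / n) * I) ^ (2 * n) = 1 := by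
  have : (n : ℂ) ≠ 0 := by exact_mod_cast (by omega : n ≠ 0)
  rw [← exp_nat_mul, exp_eq_one_iff]
  exact ⟨k, by push_cast; field_simp⟩

theorem exp_grid_eq_one_iff {n : ℕ} (hn : 1 ≤ n) (k : ℤ) :
    exp (k * (Real.pi / n) * I) = 1 ↔ (2 * n : ℤ) ∣ k := by
  have hn' : (n : ℂ) ≠ 0 := by exact_mod_cast (by omega : n ≠ 0)
  have hpi : (Real.pi : ℂ) ≠ 0 := by exact_mod_cast Real.pi_ne_zero
  rw [exp_eq_one_iff]
  constructor
  · rintro ⟨m, hm⟩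
    refine ⟨m, ?_⟩
    have : (k : ℂ) = ((2 * n * m : ℤ) : ℂ) := by
      push_cast
      field_simp at hm
      linear_combination hm
    exact_mod_cast this
  · rintro ⟨m, rfl⟩
    exact ⟨m, by push_cast; field_simp⟩

theorem sum_exp_grid {n : ℕ} (hn : 1 ≤ n) (k : ℤ) :
    ∑ j ∈ Finset.range (2 * n), exp (k * ((Real.pi * j / n : ℝ) : ℂ) * I) =
      if (2 * n : ℤ) ∣ k then (2 * n : ℂ) else 0 := by
  simp only [exp_int_mul_grid]
  split_ifs with h
  · rw [(exp_grid_eq_one_iff hn k).2 h]; simp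
  · have h1 : exp (k * (Real.pi / n) * I) ≠ 1 := fun h2 => h ((exp_grid_eq_one_iff hn k).1 h2)
    rw [geom_sum_eq h1, exp_grid_pow hn, sub_self, zero_div]

theorem exp_int_mul_two_pi (k : ℤ) : exp (k * ((2 * Real.pi : ℝ) : ℂ) * I) = 1 := by
  rw [exp_eq_one_iff]
  exact ⟨k, by push_cast; ring⟩

theorem trapSum_of_periodic {n : ℕ} (hn : 1 ≤ n) {g : ℝ → ℂ} (h : g 0 = g (2 * Real.pi)) :
    trapSum n g = Real.pi / n * ∑ j ∈ Finset.range (2 * n), g (Real.pi * j / n) := by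
  rw [trapSum, Finset.range_eq_Ico, Finset.sum_eq_sum_Ico_succ_bot (by omega : 0 < 2 * n), ← h]
  simp only [Nat.cast_zero, mul_zero, zero_div, zero_add]
  ring

theorem hasSum_of_eq {ι E : Type*} [AddCommMonoid E] [TopologicalSpace E] {f g : ι → E} {a : E}
    (h : HasSum f a) (e : ∀ i, f i = g i) :
    HasSum g a := funext e ▸ h

/-- Insert the Fourier series at the nodes: the grid sum of `e^{i(m+k)t}` vanishes unless `2n ∣ m +
k`. The surviving frequencies are `m = 2nl - k`, and `l = 0` is the exact integral. -/
theorem hasSum_trapErr {v : ℝ → ℂ} (hv : ContinuousOn v (Set.Icc 0 (2 * Real.pi)))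
    (h0 : v 0 = v (2 * Real.pi)) (hs : Summable (fourierInt v)) {n : ℕ} (hn : 1 ≤ n) (k : ℤ) :
    HasSum (fun l : ℤ => if l = 0 then 0 else 2 * Real.pi * fourierInt v (2 * n * l - k))
      (trapErr n fun t => exp (k * t * I) * v t) := by
  have hpi : (Real.pi : ℂ) ≠ 0 := by exact_mod_cast Real.pi_ne_zero
  have hn' : (n : ℂ) ≠ 0 := by exact_mod_cast (by omega : n ≠ 0)
  have hnr : (0 : ℝ) < n := by exact_mod_cast hn
  have h1 : HasSum (fun m : ℤ => if (2 * n : ℤ) ∣ m + k then 2 * Real.pi * fourierInt v m else 0)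
      (trapSum n fun t => exp (k * t * I) * v t) := by
    rw [trapSum_of_periodic hn (by
      simp only [exp_int_mul_two_pi, ofReal_zero, mul_zero, zero_mul, exp_zero, h0])]
    have h2 : ∀ j ∈ Finset.range (2 * n),
        HasSum (fun m : ℤ => fourierInt v m * exp ((m + k : ℤ) * ((Real.pi * j / n : ℝ) : ℂ) * I))
          (exp (k * ((Real.pi * j / n : ℝ) : ℂ) * I) * v (Real.pi * j / n)) := by
      intro j hj
      have hj' : (j : ℝ) < 2 * n := by exact_mod_cast Finset.mem_range.1 hj
      have hmem : Real.pi * j / n ∈ Set.Ico 0 (2 * Real.pi) := by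
        refine ⟨by positivity, ?_⟩
        rw [div_lt_iff₀ hnr]
        nlinarith [Real.pi_pos]
      refine hasSum_of_eq ((hasSum_fourierInt hv h0 hs hmem).mul_left
        (exp (k * ((Real.pi * j / n : ℝ) : ℂ) * I))) fun m => ?_
      rw [mul_left_comm, ← exp_add]
      push_cast
      ring_nf
    refine hasSum_of_eq ((hasSum_sum h2).mul_left (Real.pi / n : ℂ)) fun m => ?_
    rw [← Finset.mul_sum, sum_exp_grid hn]
    split_ifs
    · field_simp
    · simp
  have h3 : ∫ t in (0 : ℝ)..(2 * Real.pi), exp (k * t * I) * v t =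
      2 * Real.pi * fourierInt v (-k) := by
    rw [fourierInt, ← mul_assoc, mul_one_div_cancel (by simp [hpi]), one_mul]
    simp
  have h4 := h1.sub (hasSum_ite_eq (-k) (2 * Real.pi * fourierInt v (-k)))
  rw [← h3, ← trapErr] at h4
  have hinj : Function.Injective fun l : ℤ => 2 * n * l - k := fun a b hab => by
    have : (2 * n : ℤ) ≠ 0 := by omega
    simpa [sub_left_inj, this] using hab
  rw [← hinj.hasSum_iff] at h4
  · refine hasSum_of_eq h4 fun l => ?_
    have hk : (2 * n * l - k = -k) ↔ l = 0 := by
      have hn0 : n ≠ 0 := by omega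
      rw [sub_eq_neg_self]; simp [hn0]
    simp only [Function.comp_apply, sub_add_cancel, dvd_mul_right, if_true, hk]
    split_ifs with h
    · simp [h, h3]
    · simp
  · intro m hm
    have hnd : ¬ (2 * n : ℤ) ∣ m + k := by
      rintro ⟨l, hl⟩
      exact hm ⟨l, by simp only [← hl, add_sub_cancel_right]⟩
    have hmk : m ≠ -k := by rintro rfl; simp at hnd
    simp [hnd, hmk]

/-- For `l ≠ 0` and `|k| ≤ n` one has `|2nl - k| ≥ 2n|l| - n ≥ n|l|`. The factor `n^{-α}` therefore
comes out, and the sum of `|l|^{-α}` converges because `α > 1`. -/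
theorem norm_trapErr_le {v : ℝ → ℂ} (hv : ContinuousOn v (Set.Icc 0 (2 * Real.pi)))
    (h0 : v 0 = v (2 * Real.pi)) (hs : Summable (fourierInt v)) {α C : ℝ} (hα : 1 < α)
    (hC : 0 ≤ C) {n : ℕ} (hn : 1 ≤ n)
    (hb : ∀ m : ℤ, n ≤ m.natAbs → ‖fourierInt v m‖ ≤ C * (m.natAbs : ℝ) ^ (-α))
    {k : ℤ} (hk : k.natAbs ≤ n) :
    ‖trapErr n fun t => exp (k * t * I) * v t‖ ≤
      2 * Real.pi * C * (∑' l : ℤ, |(l : ℝ)| ^ (-α)) * (n : ℝ) ^ (-α) := by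
  have hnr : (0 : ℝ) < n := by exact_mod_cast hn
  have hS : Summable fun l : ℤ => |(l : ℝ)| ^ (-α) := Real.summable_abs_int_rpow hα
  have h1 := hasSum_trapErr hv h0 hs hn k
  rw [← h1.tsum_eq]
  refine tsum_of_norm_bounded (g := fun l : ℤ => 2 * Real.pi * C * |(l : ℝ)| ^ (-α) * (n : ℝ) ^ (-α))
    ?_ fun l => ?_
  · exact ((hS.hasSum.mul_left _).mul_right _)
  split_ifs with h
  · rw [norm_zero]; positivity
  · have hl : n * l.natAbs ≤ (2 * n * l - k).natAbs := by
      have h2 : (2 * n * l : ℤ).natAbs = 2 * (n * l.natAbs) := by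
        rw [Int.natAbs_mul, Int.natAbs_mul]; simp [mul_assoc]
      have h3 : 1 ≤ l.natAbs := by omega
      have h4 : n * 1 ≤ n * l.natAbs := Nat.mul_le_mul_left _ h3
      omega
    have hl1 : 1 ≤ l.natAbs := by omega
    have hnl : n ≤ n * l.natAbs := Nat.le_mul_of_pos_right _ hl1
    have h5 := hb _ (hnl.trans hl)
    have hpi := Real.pi_pos
    rw [norm_mul, norm_mul, norm_ofNat, norm_real, Real.norm_of_nonneg hpi.le]
    have h6 : ((2 * n * l - k).natAbs : ℝ) ^ (-α) ≤ |(l : ℝ)| ^ (-α) * (n : ℝ) ^ (-α) := by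
      rw [← Real.mul_rpow (abs_nonneg _) hnr.le]
      have h7 : |(l : ℝ)| = (l.natAbs : ℝ) := by rw [Nat.cast_natAbs, Int.cast_abs]
      refine Real.rpow_le_rpow_of_nonpos ?_ ?_ (by linarith)
      · rw [h7]; positivity
      · rw [h7, mul_comm]; exact_mod_cast hl
    calc _ ≤ 2 * Real.pi * (C * (|(l : ℝ)| ^ (-α) * (n : ℝ) ^ (-α))) := by
          gcongr; exact h5.trans (by gcongr)
      _ = _ := by ring

/-! ### The trapezoidal error of `t e^{ikt}` -/

theorem integral_exp_int_mul {k : ℤ} (hk : k ≠ 0) :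
    ∫ t in (0 : ℝ)..(2 * Real.pi), exp (k * t * I) = 0 := by
  have hk' : (k : ℂ) * I ≠ 0 := mul_ne_zero (by exact_mod_cast hk) I_ne_zero
  have h := integral_exp_mul_complex (a := 0) (b := 2 * Real.pi) hk'
  simp only [mul_right_comm (k : ℂ) I, exp_int_mul_two_pi] at h
  rw [h]
  simp

theorem integral_exp_int_mul_id {k : ℤ} (hk : k ≠ 0) :
    ∫ t in (0 : ℝ)..(2 * Real.pi), exp (k * t * I) * t = -(2 * Real.pi * I / k) := by
  have hk' : (k : ℂ) ≠ 0 := by exact_mod_cast hk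
  have hd : ∀ t : ℝ, HasDerivAt (fun t : ℝ => exp (k * t * I) * (-(t * I / k) + 1 / k ^ 2))
      (exp (k * t * I) * t) t := by
    intro t
    have h0 : HasDerivAt (fun t : ℝ => (t : ℂ)) 1 t := (hasDerivAt_id' t).ofReal_comp
    have h1 := ((h0.const_mul (k : ℂ)).mul_const I).cexp
    have h2 := (((h0.mul_const I).div_const (k : ℂ)).fun_neg).add_const (1 / (k : ℂ) ^ 2)
    refine (h1.mul h2).congr_deriv ?_
    field_simp
    linear_combination (-(t : ℂ) * k) * I_sq
  rw [intervalIntegral.integral_eq_sub_of_hasDerivAt (fun t _ => hd t)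
    (Continuous.intervalIntegrable (by fun_prop) _ _), exp_int_mul_two_pi]
  simp only [ofReal_zero, mul_zero, zero_mul, exp_zero]
  push_cast
  field_simp
  ring

theorem sum_nat_mul_pow {w : ℂ} {N : ℕ} (hw : w ≠ 1) (hN : w ^ N = 1) :
    ∑ j ∈ Finset.range N, (j : ℂ) * w ^ j = N / (w - 1) := by
  have key : ∀ M : ℕ, (w - 1) ^ 2 * ∑ j ∈ Finset.range M, (j : ℂ) * w ^ j =
      M * w ^ M * (w - 1) - w * (w ^ M - 1) := by
    intro M
    induction M with
    | zero => simp
    | succ M ih => rw [Finset.sum_range_succ, mul_add, ih]; push_cast; ring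
  have h1 := key N
  have h2 : w - 1 ≠ 0 := sub_ne_zero.2 hw
  rw [hN] at h1
  rw [eq_div_iff h2]
  apply mul_left_cancel₀ h2
  linear_combination h1

/-- The `j`-th term `1/(2(j+1)n - k) - 1/(2(j+1)n + k)` of the error series of `t e^{ikt}`. -/
noncomputable def aliasTerm (n : ℕ) (k : ℤ) (j : ℕ) : ℝ :=
  1 / (2 * n * (j + 1) - k) - 1 / (2 * n * (j + 1) + k)

theorem mem_integerComplement_of_natAbs_le {n : ℕ} (hn : 1 ≤ n) {k : ℤ} (hk0 : k ≠ 0)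
    (hk : k.natAbs ≤ n) : (k / (2 * n) : ℂ) ∈ integerComplement := by
  have hn' : (n : ℂ) ≠ 0 := by exact_mod_cast (by omega : n ≠ 0)
  rw [mem_integerComplement_iff]
  rintro ⟨m, hm⟩
  rw [eq_div_iff (by simp [hn'])] at hm
  have h1 : m * (2 * n) = k := by exact_mod_cast hm
  have h2 : k.natAbs = m.natAbs * (2 * n) := by rw [← h1, Int.natAbs_mul]; simp [Int.natAbs_mul]
  have h3 : m.natAbs ≠ 0 := by
    intro h
    rw [h, zero_mul] at h2
    omega
  have h4 : 1 * (2 * n) ≤ m.natAbs * (2 * n) := Nat.mul_le_mul_right _ (by omega)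
  omega

theorem two_mul_succ_sub_ge {n : ℕ} {k : ℤ} (hk : k.natAbs ≤ n) (j : ℕ) :
    (n : ℝ) ≤ 2 * n * (j + 1) - k ∧ (n : ℝ) ≤ 2 * n * (j + 1) + k := by
  have h1 : |(k : ℝ)| ≤ n := by
    rw [← Int.cast_abs, ← Nat.cast_natAbs]; exact_mod_cast hk
  have h2 := abs_le.1 h1
  have h3 : (0 : ℝ) ≤ n * j := by positivity
  constructor <;> nlinarith

theorem cotTerm_eq_aliasTerm {n : ℕ} (hn : 1 ≤ n) {k : ℤ} (hk : k.natAbs ≤ n) (j : ℕ) :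
    (1 / ((k / (2 * n) : ℂ) - (j + 1)) + 1 / ((k / (2 * n) : ℂ) + (j + 1))) =
      -(2 * n) * (aliasTerm n k j : ℂ) := by
  have hn' : (n : ℂ) ≠ 0 := by exact_mod_cast (by omega : n ≠ 0)
  have hnr : (0 : ℝ) < n := by exact_mod_cast hn
  obtain ⟨h1, h2⟩ := two_mul_succ_sub_ge hk j
  have h3 : (2 * n * (j + 1) - k : ℂ) ≠ 0 := by
    exact_mod_cast (hnr.trans_le h1).ne'
  have h4 : (2 * n * (j + 1) + k : ℂ) ≠ 0 := by
    exact_mod_cast (hnr.trans_le h2).ne'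
  have e1 : (k / (2 * n) : ℂ) - (j + 1) = -(2 * n * (j + 1) - k) / (2 * n) := by
    field_simp; ring
  have e2 : (k / (2 * n) : ℂ) + (j + 1) = (2 * n * (j + 1) + k) / (2 * n) := by
    field_simp; ring
  rw [e1, e2, aliasTerm]
  push_cast
  field_simp
  ring

theorem summable_aliasTerm {n : ℕ} (hn : 1 ≤ n) {k : ℤ} (hk : k.natAbs ≤ n) :
    Summable (aliasTerm n k) := by
  rcases eq_or_ne k 0 with rfl | hk0
  · have : aliasTerm n 0 = fun _ => 0 := by ext j; simp [aliasTerm]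
    rw [this]; exact summable_zero
  have h := summable_cotTerm (mem_integerComplement_of_natAbs_le hn hk0 hk)
  have hn' : (n : ℂ) ≠ 0 := by exact_mod_cast (by omega : n ≠ 0)
  have h2 : ∀ j, cotTerm (k / (2 * n) : ℂ) j = -(2 * n) * (aliasTerm n k j : ℂ) := fun j =>
    cotTerm_eq_aliasTerm hn hk j
  rw [funext h2, summable_mul_left_iff (by simp [hn'])] at h
  exact_mod_cast h

theorem trapErr_exp_mul_id {n : ℕ} (hn : 1 ≤ n) {k : ℤ} (hk : k.natAbs ≤ n) :
    trapErr n (fun t => exp (k * t * I) * t) = 2 * Real.pi * I * (∑' j, aliasTerm n k j : ℝ) := by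
  have hn' : (n : ℂ) ≠ 0 := by exact_mod_cast (by omega : n ≠ 0)
  have hpi : (Real.pi : ℂ) ≠ 0 := by exact_mod_cast Real.pi_ne_zero
  have hsum : ∑ j ∈ Finset.Ico 1 (2 * n),
      exp (k * ((Real.pi * j / n : ℝ) : ℂ) * I) * ((Real.pi * j / n : ℝ) : ℂ) =
      Real.pi / n * ∑ j ∈ Finset.range (2 * n), (j : ℂ) * exp (k * (Real.pi / n) * I) ^ j := by
    rw [Finset.range_eq_Ico, Finset.sum_eq_sum_Ico_succ_bot (by omega : 0 < 2 * n)]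
    simp only [Nat.cast_zero, zero_mul, zero_add, Finset.mul_sum]
    refine Finset.sum_congr rfl fun j _ => ?_
    rw [exp_int_mul_grid]
    push_cast
    ring
  rw [trapErr, trapSum, hsum, exp_int_mul_two_pi]
  simp only [ofReal_zero, mul_zero, zero_div, zero_add, one_mul]
  rcases eq_or_ne k 0 with rfl | hk0
  · have h1 : ∑ j ∈ Finset.range (2 * n), (j : ℂ) = n * (2 * n - 1) := by
      have h2 := Finset.sum_range_id_mul_two (2 * n)
      have h3 : (((∑ j ∈ Finset.range (2 * n), j) * 2 : ℕ) : ℂ) = ((2 * n * (2 * n - 1) : ℕ) : ℂ) :=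
        congrArg _ h2
      rw [Nat.cast_mul, Nat.cast_mul, Nat.cast_sub (by omega)] at h3
      push_cast at h3
      linear_combination h3 / 2
    have h4 : ∀ j, aliasTerm n 0 j = 0 := fun j => by simp [aliasTerm]
    have h5 : ∫ t in (0 : ℝ)..(2 * Real.pi), (t : ℂ) = 2 * Real.pi ^ 2 := by
      rw [intervalIntegral.integral_ofReal, integral_id]
      push_cast; ring
    simp only [Int.cast_zero, zero_mul, exp_zero, one_pow, mul_one, h1, one_mul, h5, h4, tsum_zero,
      ofReal_zero, mul_zero]
    push_cast
    field_simp
    ring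
  have hk' : (k : ℂ) ≠ 0 := by exact_mod_cast hk0
  set w := exp (k * (Real.pi / n) * I) with hw
  have hw1 : w ≠ 1 := by
    rw [hw, Ne, exp_grid_eq_one_iff hn]
    rintro ⟨m, rfl⟩
    rw [Int.natAbs_mul, Int.natAbs_mul] at hk
    have h3 : m.natAbs ≠ 0 := by
      intro h
      rw [Int.natAbs_eq_zero] at h
      simp [h] at hk0
    have h4 : n * 1 ≤ n * m.natAbs := Nat.mul_le_mul_left _ (by omega)
    simp only [Int.natAbs_natCast, Int.reduceAbs, mul_assoc] at hk
    omega
  have hw2 : w - 1 ≠ 0 := sub_ne_zero.2 hw1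
  have hw3 : 1 - w ≠ 0 := sub_ne_zero.2 hw1.symm
  have hcot := cot_series_rep' (mem_integerComplement_of_natAbs_le hn hk0 hk)
  rw [cot_pi_eq_exp_ratio, show 2 * Real.pi * I * (k / (2 * n)) = k * (Real.pi / n) * I by
    field_simp, ← hw, tsum_congr (cotTerm_eq_aliasTerm hn hk), tsum_mul_left, ← ofReal_tsum] at hcot
  rw [sum_nat_mul_pow hw1 (exp_grid_pow hn k), integral_exp_int_mul_id hk0]
  set Q : ℂ := ((∑' j, aliasTerm n k j : ℝ) : ℂ)
  have hcot2 : Real.pi * (w + 1) / (w - 1) = -I * (2 * n / k - 2 * n * Q) := by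
    have h1 : Real.pi * ((w + 1) / (I * (1 - w))) = I * (Real.pi * (w + 1) / (w - 1)) := by
      field_simp
      linear_combination (w ^ 2 - 1) * I_sq
    rw [h1] at hcot
    have h2 : 1 / (k / (2 * n) : ℂ) = 2 * n / k := by field_simp
    rw [h2] at hcot
    linear_combination (-I) * hcot + (Real.pi * (w + 1) / (w - 1)) * I_sq
  have h3 : Real.pi / n * (Real.pi / n * (((2 * n : ℕ) : ℂ) / (w - 1)) + (2 * Real.pi : ℝ) / 2) =
      Real.pi / n * (Real.pi * (w + 1) / (w - 1)) := by
    push_cast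
    field_simp
    ring
  rw [h3, hcot2]
  field_simp
  ring

theorem trapErr_exp {n : ℕ} (hn : 1 ≤ n) {k : ℤ} (hk : k.natAbs ≤ n) :
    trapErr n (fun t => exp (k * t * I)) = 0 := by
  have h0 : ∀ m : ℤ, m ≠ 0 → fourierInt (fun _ => 1) m = 0 := fun m hm => by
    have := integral_exp_int_mul (neg_ne_zero.2 hm)
    push_cast at this
    simp only [fourierInt, mul_one, ← neg_mul, this, mul_zero]
  have h := norm_trapErr_le (v := fun _ => 1) continuousOn_const rfl
    (summable_of_ne_finset_zero (s := {0}) fun m hm => h0 m (by simpa using hm))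
    one_lt_two le_rfl hn (fun m hm => by rw [h0 m (by omega)]; simp) hk
  simpa using h

/-- The trapezoidal error of `w e^{ikt}`, where `w` minus a linear function has rapidly decaying
Fourier coefficients. -/
theorem exists_norm_trapErr_sub_le {w : ℝ → ℂ} (hw : Continuous w) {α : ℝ} (hα : 1 < α)
    (hdecay : ∃ C, 0 ≤ C ∧ ∀ᶠ m : ℕ in atTop, ∀ s : ℤ, s.natAbs = m →
      ‖(∫ t in (0 : ℝ)..(2 * Real.pi), exp (-(s * t * I)) * w t) -
        (w (2 * Real.pi) - w 0) * (I / s)‖ ≤ C * (m : ℝ) ^ (-α)) :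
    ∃ C, 0 ≤ C ∧ ∀ᶠ n : ℕ in atTop, ∀ k : ℤ, k.natAbs ≤ n →
      ‖trapErr n (fun t => exp (k * t * I) * w t) -
        (w (2 * Real.pi) - w 0) * I * (∑' j, aliasTerm n k j : ℝ)‖ ≤ C * (n : ℝ) ^ (-α) := by
  obtain ⟨C, hC0, hC⟩ := hdecay
  have hpi : (Real.pi : ℂ) ≠ 0 := by exact_mod_cast Real.pi_ne_zero
  have hpi' := Real.pi_pos
  obtain ⟨m₀, hm₀⟩ := eventually_atTop.1 hC
  set d := (w (2 * Real.pi) - w 0) / (2 * Real.pi) with hd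
  set v : ℝ → ℂ := fun t => w t - (w 0 + d * t) with hv
  have hvc : Continuous v := by fun_prop
  have hdpi : d * (2 * Real.pi) = w (2 * Real.pi) - w 0 := by rw [hd]; field_simp
  have hv0 : v 0 = v (2 * Real.pi) := by
    simp only [hv]
    push_cast
    linear_combination hdpi
  have hint : ∀ f : ℝ → ℂ, Continuous f → IntervalIntegrable f volume 0 (2 * Real.pi) :=
    fun f hf => hf.intervalIntegrable _ _
  have hcoef : ∀ s : ℤ, s ≠ 0 → fourierInt v s = 1 / (2 * Real.pi) *
      ((∫ t in (0 : ℝ)..(2 * Real.pi), exp (-(s * t * I)) * w t) -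
        (w (2 * Real.pi) - w 0) * (I / s)) := by
    intro s hs
    have hs' : (s : ℂ) ≠ 0 := by exact_mod_cast hs
    have e1 := integral_exp_int_mul (neg_ne_zero.2 hs)
    have e2 := integral_exp_int_mul_id (neg_ne_zero.2 hs)
    push_cast at e1 e2
    simp only [neg_mul] at e1 e2
    rw [fourierInt]
    congr 1
    have e3 : ∀ t : ℝ, exp (-(s * t * I)) * v t = exp (-(s * t * I)) * w t -
        (w 0 * exp (-(s * t * I)) + d * (exp (-(s * t * I)) * t)) := fun t => by
      simp only [hv]; ring
    simp only [e3]
    rw [intervalIntegral.integral_sub (hint _ (by fun_prop)) (hint _ (by fun_prop)),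
      intervalIntegral.integral_add (hint _ (by fun_prop)) (hint _ (by fun_prop)),
      intervalIntegral.integral_const_mul, intervalIntegral.integral_const_mul, e1, e2, ← hdpi]
    generalize (∫ t in (0 : ℝ)..(2 * Real.pi), exp (-(s * t * I)) * w t) = X
    field_simp
    ring
  have hb : ∀ m : ℤ, m₀ + 1 ≤ m.natAbs → ‖fourierInt v m‖ ≤ C * (m.natAbs : ℝ) ^ (-α) := by
    intro m hm
    have h1 := hm₀ m.natAbs (by omega) m rfl
    rw [hcoef m (by omega), norm_mul]
    refine (mul_le_of_le_one_left (norm_nonneg _) ?_).trans h1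
    rw [show (1 / (2 * Real.pi) : ℂ) = ((1 / (2 * Real.pi) : ℝ) : ℂ) by push_cast; rfl, norm_real,
      Real.norm_of_nonneg (by positivity), div_le_one (by positivity)]
    linarith [Real.pi_gt_three]
  have hs : Summable (fourierInt v) := by
    have hS : Summable fun l : ℤ => C * |(l : ℝ)| ^ (-α) := (Real.summable_abs_int_rpow hα).mul_left C
    refine Summable.of_norm_bounded_eventually hS ?_
    have hfin : (Set.Icc (-(m₀ : ℤ)) m₀).Finite := Set.finite_Icc _ _
    refine hfin.subset fun m hm => ?_
    by_contra hcon
    refine hm ?_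
    have h1 : m₀ + 1 ≤ m.natAbs := by
      rw [Set.mem_Icc] at hcon
      omega
    have := hb m h1
    rwa [Nat.cast_natAbs, Int.cast_abs] at this
  refine ⟨2 * Real.pi * C * (∑' l : ℤ, |(l : ℝ)| ^ (-α)), ?_, ?_⟩
  · have : 0 ≤ ∑' l : ℤ, |(l : ℝ)| ^ (-α) := tsum_nonneg fun l => by positivity
    positivity
  filter_upwards [eventually_ge_atTop (m₀ + 1)] with n hn k hk
  have hn1 : 1 ≤ n := by omega
  have h1 := norm_trapErr_le hvc.continuousOn hv0 hs hα hC0 hn1 (fun m hm => hb m (by omega)) hk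
  have h2 : (fun t : ℝ => exp (k * t * I) * w t) = fun t : ℝ => exp (k * t * I) * v t +
      (w 0 * exp (k * t * I) + d * (exp (k * t * I) * t)) := by
    ext t; simp only [hv]; ring
  rw [h2, trapErr_add (hint _ (by fun_prop)) (hint _ (by fun_prop)),
    trapErr_add (hint _ (by fun_prop)) (hint _ (by fun_prop)), trapErr_const_mul,
    trapErr_const_mul, trapErr_exp hn1 hk, trapErr_exp_mul_id hn1 hk, ← hdpi]
  convert h1 using 2
  ring

/-! ### The truncated Laurent series and its tails -/

/-- The coefficients of `laurentMid K n`: Laurent coefficients with the extreme ones halved. -/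
noncomputable def midCoeff (K : ℂ → ℂ) (n : ℕ) (k : ℤ) : ℂ :=
  if k.natAbs = n then 1 / 2 * laurentCoeff K k else laurentCoeff K k

theorem norm_midCoeff_le (K : ℂ → ℂ) (n : ℕ) (k : ℤ) : ‖midCoeff K n k‖ ≤ ‖laurentCoeff K k‖ := by
  rw [midCoeff]
  split_ifs
  · rw [norm_mul]
    refine mul_le_of_le_one_left (norm_nonneg _) (by norm_num)
  · exact le_rfl

theorem laurentMid_eq_sum (K : ℂ → ℂ) {n : ℕ} (hn : 1 ≤ n) (z : ℂ) :
    laurentMid K n z = ∑ k ∈ Finset.Icc (-n : ℤ) n, midCoeff K n k * z ^ k := by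
  have h : Finset.Icc (-n : ℤ) n = insert (-n : ℤ) (insert (n : ℤ) (Finset.Ioo (-n : ℤ) n)) := by
    ext k
    simp only [Finset.mem_Icc, Finset.mem_insert, Finset.mem_Ioo]
    omega
  rw [h, Finset.sum_insert (by simp; omega), Finset.sum_insert (by simp), laurentMid]
  have h2 : ∑ k ∈ Finset.Ioo (-n : ℤ) n, midCoeff K n k * z ^ k =
      ∑ k ∈ Finset.Ioo (-n : ℤ) n, laurentCoeff K k * z ^ k := by
    refine Finset.sum_congr rfl fun k hk => ?_
    rw [Finset.mem_Ioo] at hk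
    rw [midCoeff, if_neg (by omega)]
  rw [h2, midCoeff, midCoeff, if_pos (by simp), if_pos (by simp), zpow_natCast]
  ring

/-- The tail `½ aₙ zⁿ + ∑_{k > n} aₖ zᵏ` of a power series. -/
noncomputable def halfTail (a : ℕ → ℂ) (n : ℕ) (z : ℂ) : ℂ :=
  1 / 2 * a n * z ^ n + ∑' j : ℕ, a (n + 1 + j) * z ^ (n + 1 + j)

theorem laurentPlus_eq_halfTail (K : ℂ → ℂ) (n : ℕ) (z : ℂ) :
    laurentPlus K n z = halfTail (fun k => laurentCoeff K k) n z := by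
  rw [laurentPlus, halfTail]
  congr 2

theorem laurentMinus_eq_halfTail (K : ℂ → ℂ) (n : ℕ) (z : ℂ) :
    laurentMinus K n z = halfTail (fun k => laurentCoeff K (-k)) n z⁻¹ := by
  rw [laurentMinus, halfTail, add_comm]
  congr 2
  · rw [zpow_neg, zpow_natCast, inv_pow]
  · ext j
    rw [← zpow_natCast, inv_zpow, zpow_neg]
    push_cast
    rfl

section tails

variable {a : ℕ → ℂ} {M q : ℝ}

theorem norm_term_le (ha : ∀ k, ‖a k‖ ≤ M * q ^ k) {ρ : ℝ} (k : ℕ) {z : ℂ} (hz : ‖z‖ ≤ ρ) :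
    ‖a k * z ^ k‖ ≤ M * (q * ρ) ^ k := by
  rw [norm_mul, norm_pow, mul_pow, ← mul_assoc]
  have h0 := (norm_nonneg (a k)).trans (ha k)
  exact mul_le_mul (ha k) (pow_le_pow_left₀ (norm_nonneg _) hz k) (by positivity) h0

theorem summable_shift_geometric {x : ℝ} (h0 : 0 ≤ x) (h1 : x < 1) (n : ℕ) :
    HasSum (fun j : ℕ => M * x ^ (n + 1 + j)) (M * x ^ (n + 1) * (1 - x)⁻¹) := by
  simp only [pow_add _ (n + 1), ← mul_assoc]
  exact (hasSum_geometric_of_lt_one h0 h1).mul_left _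

theorem norm_halfTail_le (ha : ∀ k, ‖a k‖ ≤ M * q ^ k) (hq0 : 0 ≤ q) (hq1 : q < 1) (n : ℕ)
    {z : ℂ} (hz : ‖z‖ ≤ 1) : ‖halfTail a n z‖ ≤ M / (1 - q) * q ^ n := by
  have hM : 0 ≤ M := by simpa using (norm_nonneg _).trans (ha 0)
  have h1 := norm_term_le ha n hz
  have h2 : ‖∑' j : ℕ, a (n + 1 + j) * z ^ (n + 1 + j)‖ ≤ M * q ^ (n + 1) * (1 - q)⁻¹ := by
    refine tsum_of_norm_bounded (summable_shift_geometric hq0 hq1 n) fun j => ?_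
    simpa using norm_term_le ha (n + 1 + j) hz
  rw [mul_one] at h1
  rw [halfTail]
  refine (norm_add_le _ _).trans ?_
  rw [mul_assoc, norm_mul]
  have h3 : ‖(1 / 2 : ℂ)‖ ≤ 1 := by norm_num
  have h4 : M / (1 - q) * q ^ n = M * q ^ n + M * q ^ (n + 1) * (1 - q)⁻¹ := by
    have : 1 - q ≠ 0 := by linarith
    field_simp
    ring
  rw [h4]
  exact add_le_add ((mul_le_of_le_one_left (norm_nonneg _) h3).trans h1) h2

theorem continuousOn_halfTail (ha : ∀ k, ‖a k‖ ≤ M * q ^ k) (hq0 : 0 ≤ q) {ρ : ℝ} (hρ0 : 0 ≤ ρ)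
    (hρ : q * ρ < 1) (n : ℕ) : ContinuousOn (halfTail a n) (Metric.closedBall 0 ρ) := by
  refine ContinuousOn.add (by fun_prop) ?_
  refine continuousOn_tsum (fun j => by fun_prop)
    (summable_shift_geometric (M := M) (mul_nonneg hq0 hρ0) hρ n).summable fun j z hz => ?_
  exact norm_term_le ha (n + 1 + j) (by simpa using hz)

end tails

theorem eq_laurentMid_add {K : ℂ → ℂ} {n : ℕ} (hn : 1 ≤ n) {z : ℂ}
    (h : HasSum (fun m : ℤ => laurentCoeff K m * z ^ m) (K z)) :
    K z = laurentMid K n z + laurentPlus K n z + laurentMinus K n z := by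
  set f : ℤ → ℂ := fun m => laurentCoeff K m * z ^ m with hf
  have hinj1 : Function.Injective fun j : ℕ => (n + 1 + j : ℤ) := fun a b hab => by
    simpa using hab
  have hinj2 : Function.Injective fun j : ℕ => (-(n + 1 + j) : ℤ) := fun a b hab => by
    simpa using hab
  have h1 : HasSum (fun m : ℤ => if (n : ℤ) < m then f m else 0) (∑' j : ℕ, f (n + 1 + j)) := by
    rw [← hinj1.hasSum_iff]
    · refine hasSum_of_eq (h.summable.comp_injective hinj1).hasSum fun j => ?_
      simp only [Function.comp_apply]
      rw [if_pos (by omega)]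
    · intro m hm
      refine if_neg fun hlt => hm ⟨(m - (n + 1)).toNat, ?_⟩
      simp only
      omega
  have h2 : HasSum (fun m : ℤ => if m < -(n : ℤ) then f m else 0)
      (∑' j : ℕ, f (-(n + 1 + j))) := by
    rw [← hinj2.hasSum_iff]
    · refine hasSum_of_eq (h.summable.comp_injective hinj2).hasSum fun j => ?_
      simp only [Function.comp_apply]
      rw [if_pos (by omega)]
    · intro m hm
      refine if_neg fun hlt => hm ⟨(-m - (n + 1)).toNat, ?_⟩
      simp only
      omega
  have h3 : HasSum (fun m : ℤ => if m ∈ Finset.Icc (-n : ℤ) n then f m else 0)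
      (∑ m ∈ Finset.Icc (-n : ℤ) n, f m) := by
    have h := hasSum_sum_of_ne_finset_zero (L := .unconditional ℤ) (s := Finset.Icc (-n : ℤ) n)
      (f := fun m : ℤ => if m ∈ Finset.Icc (-n : ℤ) n then f m else 0) fun m hm => if_neg hm
    rwa [Finset.sum_congr rfl fun m hm => if_pos hm] at h
  have h4 := h.unique (hasSum_of_eq ((h3.add h1).add h2) fun m => by
    simp only [Finset.mem_Icc]
    rcases lt_or_ge m (-n : ℤ) with h5 | h5
    · rw [if_neg (by omega), if_neg (by omega), if_pos h5, zero_add, zero_add]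
    rcases le_or_gt m n with h6 | h6
    · rw [if_pos ⟨h5, h6⟩, if_neg (by omega), if_neg (by omega), add_zero, add_zero]
    · rw [if_neg (by omega), if_pos h6, if_neg (by omega), zero_add, add_zero])
  have h5 : ∑ m ∈ Finset.Icc (-n : ℤ) n, f m =
      laurentMid K n z + 1 / 2 * laurentCoeff K n * z ^ n +
        1 / 2 * laurentCoeff K (-n) * z ^ (-n : ℤ) := by
    have h : Finset.Icc (-n : ℤ) n = insert (-n : ℤ) (insert (n : ℤ) (Finset.Ioo (-n : ℤ) n)) := by
      ext k
      simp only [Finset.mem_Icc, Finset.mem_insert, Finset.mem_Ioo]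
      omega
    rw [h, Finset.sum_insert (by simp; omega), Finset.sum_insert (by simp), laurentMid]
    simp only [hf, zpow_natCast]
    ring
  rw [h4, h5, laurentPlus, laurentMinus]
  ring

/-! ### The integrals of the correction kernel for monomials -/

/-- `y⁻ⁿ (yᵏ - y⁻ᵏ) / (yⁿ - y⁻ⁿ) / y`. -/
noncomputable def monoKernel (n : ℕ) (k : ℤ) (y : ℝ) : ℝ :=
  y ^ (-n : ℤ) * (y ^ k - y ^ (-k)) / (y ^ n - y ^ (-n : ℤ)) / y

theorem sub_one_le_pow_sub {n : ℕ} (hn : 1 ≤ n) {y : ℝ} (hy : 1 ≤ y) :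
    y - 1 ≤ y ^ n - y ^ (-n : ℤ) := by
  have h1 : y ^ 1 ≤ y ^ n := pow_le_pow_right₀ hy hn
  have h2 : y ^ (-n : ℤ) ≤ 1 := zpow_le_one_of_nonpos₀ hy (by omega)
  rw [pow_one] at h1
  linarith

theorem intervalIntegrable_monoKernel {n : ℕ} (hn : 1 ≤ n) {k : ℤ} (hk : k.natAbs ≤ n) {ρ : ℝ}
    (hρ : 1 < ρ) : IntervalIntegrable (monoKernel n k) volume 1 ρ := by
  rw [intervalIntegrable_iff_integrableOn_Ioc_of_le hρ.le]
  have hc : ContinuousOn (monoKernel n k) (Set.Ioc 1 ρ) := by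
    intro y hy
    have hy0 : y ≠ 0 := by linarith [hy.1]
    have hd : y ^ n - y ^ (-n : ℤ) ≠ 0 := by
      have := sub_one_le_pow_sub hn hy.1.le; linarith [hy.1]
    have hz : ∀ m : ℤ, ContinuousAt (fun y : ℝ => y ^ m) y := fun m =>
      continuousAt_zpow₀ y m (Or.inl hy0)
    exact ((((hz _).mul ((hz _).sub (hz _))).div ((continuousAt_id.pow n).sub (hz _)) hd).div
      continuousAt_id hy0).continuousWithinAt
  refine Integrable.of_bound (hc.aestronglyMeasurable measurableSet_Ioc) 1 ?_
  refine (ae_restrict_iff' measurableSet_Ioc).2 (ae_of_all _ fun y hy => ?_)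
  have hy1 := hy.1.le
  have hy0 : 0 < y := by linarith
  have hd : 0 < y ^ n - y ^ (-n : ℤ) := by
    have := sub_one_le_pow_sub hn hy1; linarith [hy.1]
  have h1 : ∀ m : ℤ, m.natAbs ≤ n → y ^ (-n : ℤ) ≤ y ^ m ∧ y ^ m ≤ y ^ n := fun m hm =>
    ⟨zpow_le_zpow_right₀ hy1 (by omega), by
      rw [← zpow_natCast]; exact zpow_le_zpow_right₀ hy1 (by omega)⟩
  have h2 : |y ^ k - y ^ (-k)| ≤ y ^ n - y ^ (-n : ℤ) := by
    rw [abs_le]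
    have := h1 k hk
    have := h1 (-k) (by omega)
    constructor <;> linarith
  have h3 : y ^ (-n : ℤ) ≤ 1 := zpow_le_one_of_nonpos₀ hy1 (by omega)
  rw [Real.norm_eq_abs, monoKernel, abs_div, abs_div, abs_mul, abs_of_pos hd, abs_of_pos hy0,
    abs_of_pos (zpow_pos hy0 _), div_le_one hy0, div_le_iff₀ hd]
  calc y ^ (-n : ℤ) * |y ^ k - y ^ (-k)| ≤ 1 * (y ^ n - y ^ (-n : ℤ)) := by gcongr
    _ ≤ y * (y ^ n - y ^ (-n : ℤ)) := by gcongr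

theorem hasSum_monoKernel {n : ℕ} (hn : 1 ≤ n) (k : ℤ) {y : ℝ} (hy : 1 < y) :
    HasSum (fun j : ℕ => y ^ (k - 2 * n * (j + 1) - 1 : ℤ) - y ^ (-k - 2 * n * (j + 1) - 1 : ℤ))
      (monoKernel n k y) := by
  have hy0 : 0 < y := by linarith
  have hx0 : 0 ≤ y ^ (-(2 * n) : ℤ) := by positivity
  have hx1 : y ^ (-(2 * n) : ℤ) < 1 := by
    rw [zpow_neg]
    exact inv_lt_one_of_one_lt₀ (one_lt_zpow₀ hy (by omega))
  have h := (hasSum_geometric_of_lt_one hx0 hx1).mul_left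
    ((y ^ k - y ^ (-k)) * y⁻¹ * y ^ (-(2 * n) : ℤ))
  suffices hval : (y ^ k - y ^ (-k)) * y⁻¹ * y ^ (-(2 * n) : ℤ) * (1 - y ^ (-(2 * n) : ℤ))⁻¹ =
      monoKernel n k y by
    rw [← hval]
    refine hasSum_of_eq h fun j => ?_
    have e : ∀ m : ℤ, y ^ (m - 2 * n * (j + 1) - 1) =
        y ^ m * y⁻¹ * y ^ (-(2 * n) : ℤ) * (y ^ (-(2 * n) : ℤ)) ^ j := by
      intro m
      rw [← zpow_natCast (y ^ (-(2 * n) : ℤ)) j, ← zpow_mul, ← zpow_neg_one, ← zpow_add₀ hy0.ne',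
        ← zpow_add₀ hy0.ne', ← zpow_add₀ hy0.ne']
      congr 1
      ring
    rw [e, e]
    ring
  have hd : 0 < y ^ n - y ^ (-n : ℤ) := by
    have := sub_one_le_pow_sub hn hy.le; linarith
  have hd2 : 1 - y ^ (-(2 * n) : ℤ) ≠ 0 := by linarith
  have e : (1 - y ^ (-(2 * n) : ℤ)) * y ^ n = y ^ n - y ^ (-n : ℤ) := by
    rw [sub_mul, one_mul, ← zpow_natCast y n, ← zpow_add₀ hy0.ne']
    congr 2; ring
  have e2 : y ^ (-(2 * n) : ℤ) * y ^ n = y ^ (-n : ℤ) := by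
    rw [← zpow_natCast y n, ← zpow_add₀ hy0.ne']
    congr 1; ring
  have hyn : y ^ n ≠ 0 := by positivity
  rw [monoKernel, ← e, ← e2]
  generalize y ^ (-(2 * n) : ℤ) = X at *
  field_simp

theorem integral_zpow_sub_one {m : ℤ} (hm : m ≠ 0) {ρ : ℝ} (hρ : 1 < ρ) :
    ∫ y in (1 : ℝ)..ρ, y ^ (m - 1) = (ρ ^ m - 1) / m := by
  rw [integral_zpow (Or.inr ⟨by omega, fun h => by
    rw [Set.uIcc_of_le hρ.le] at h; linarith [h.1]⟩)]
  simp

theorem abs_integral_monoKernel_sub_le_of_nonneg {n : ℕ} (hn : 1 ≤ n) {k : ℕ} (hk : k ≤ n) {ρ : ℝ}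
    (hρ : 1 < ρ) :
    |(∫ y in (1 : ℝ)..ρ, monoKernel n k y) - ∑' j, aliasTerm n k j| ≤
      2 / (1 - ρ⁻¹) * (ρ⁻¹ ^ (2 * n) * ρ ^ k) := by
  have hρ0 : 0 < ρ := by linarith
  have hnr : (1 : ℝ) ≤ n := by exact_mod_cast hn
  set f : ℕ → ℝ → ℝ := fun j y =>
    y ^ ((k : ℤ) - 2 * n * (j + 1) - 1 : ℤ) - y ^ (-(k : ℤ) - 2 * n * (j + 1) - 1 : ℤ) with hf
  set e : ℕ → ℝ := fun j => ρ ^ ((k : ℤ) - 2 * n * (j + 1)) / (2 * n * (j + 1) - k) -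
    ρ ^ (-(k : ℤ) - 2 * n * (j + 1)) / (2 * n * (j + 1) + k) with he
  have hden : ∀ j : ℕ, (1 : ℝ) ≤ 2 * n * (j + 1) - k ∧ (1 : ℝ) ≤ 2 * n * (j + 1) + k := fun j => by
    have := two_mul_succ_sub_ge (n := n) (k := (k : ℤ)) (by simpa using hk) j
    push_cast at this
    exact ⟨hnr.trans this.1, hnr.trans this.2⟩
  have hfi : ∀ j, IntervalIntegrable (f j) volume 1 ρ := fun j => by
    refine ContinuousOn.intervalIntegrable fun y hy => ?_
    rw [Set.uIcc_of_le hρ.le] at hy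
    have hy0 : y ≠ 0 := by linarith [hy.1]
    exact ((continuousAt_zpow₀ y _ (Or.inl hy0)).sub
      (continuousAt_zpow₀ y _ (Or.inl hy0))).continuousWithinAt
  have hkn : ∀ j : ℕ, (2 * n : ℤ) ≤ 2 * n * (j + 1) := fun j => by
    have : (0 : ℤ) ≤ 2 * n * j := by positivity
    linarith
  have hfint : ∀ j, ∫ y in (1 : ℝ)..ρ, f j y = aliasTerm n k j - e j := by
    intro j
    have hz : ∀ m : ℤ, IntervalIntegrable (fun y : ℝ => y ^ m) volume 1 ρ := fun m =>
      intervalIntegral.intervalIntegrable_zpow (Or.inr fun h => by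
        rw [Set.uIcc_of_le hρ.le] at h; linarith [h.1])
    have := hkn j
    rw [hf]
    simp only
    rw [intervalIntegral.integral_sub (hz _) (hz _), integral_zpow_sub_one (by omega) hρ,
      integral_zpow_sub_one (by omega) hρ, aliasTerm, he]
    obtain ⟨h1, h2⟩ := hden j
    have h3 : (2 * n * (j + 1) - k : ℝ) ≠ 0 := by linarith
    have h4 : (2 * n * (j + 1) + k : ℝ) ≠ 0 := by linarith
    have h5 : (k - 2 * n * (j + 1) : ℝ) = -(2 * n * (j + 1) - k) := by ring
    have h6 : (-k - 2 * n * (j + 1) : ℝ) = -(2 * n * (j + 1) + k) := by ring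
    push_cast
    rw [h5, h6]
    generalize (2 * n * (j + 1) - k : ℝ) = X at *
    generalize (2 * n * (j + 1) + k : ℝ) = Y at *
    field_simp
    ring
  have heb : ∀ j, ‖e j‖ ≤ 2 * (ρ⁻¹ ^ (2 * n) * ρ ^ k) * ρ⁻¹ ^ j := by
    intro j
    obtain ⟨h1, h2⟩ := hden j
    have h3 : ρ ^ ((k : ℤ) - 2 * n * (j + 1)) ≤ ρ⁻¹ ^ (2 * n) * ρ ^ k * ρ⁻¹ ^ j := by
      have e1 : ρ⁻¹ ^ (2 * n) * ρ ^ k * ρ⁻¹ ^ j = ρ ^ ((k : ℤ) - 2 * n - j) := by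
        rw [inv_pow, inv_pow, ← zpow_natCast, ← zpow_natCast, ← zpow_natCast, ← zpow_neg,
          ← zpow_neg, ← zpow_add₀ hρ0.ne', ← zpow_add₀ hρ0.ne']
        congr 1
        push_cast
        ring
      rw [e1]
      refine zpow_le_zpow_right₀ hρ.le ?_
      have h7 : (1 : ℤ) * j ≤ 2 * n * j := by
        refine mul_le_mul_of_nonneg_right ?_ (by positivity)
        omega
      linarith
    have h4 : ρ ^ (-(k : ℤ) - 2 * n * (j + 1)) ≤ ρ ^ ((k : ℤ) - 2 * n * (j + 1)) :=
      zpow_le_zpow_right₀ hρ.le (by omega)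
    have hp : ∀ m : ℤ, 0 < ρ ^ m := fun m => zpow_pos hρ0 m
    have h5 : ρ ^ ((k : ℤ) - 2 * n * (j + 1)) / (2 * n * (j + 1) - k) ≤
        ρ ^ ((k : ℤ) - 2 * n * (j + 1)) := div_le_self (hp _).le h1
    have h6 : ρ ^ (-(k : ℤ) - 2 * n * (j + 1)) / (2 * n * (j + 1) + k) ≤
        ρ ^ (-(k : ℤ) - 2 * n * (j + 1)) := div_le_self (hp _).le h2
    have h7 : 0 ≤ ρ ^ ((k : ℤ) - 2 * n * (j + 1)) / (2 * n * (j + 1) - k) :=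
      div_nonneg (hp _).le (by linarith)
    have h8 : 0 ≤ ρ ^ (-(k : ℤ) - 2 * n * (j + 1)) / (2 * n * (j + 1) + k) :=
      div_nonneg (hp _).le (by linarith)
    rw [Real.norm_eq_abs, abs_le]
    simp only [he]
    constructor <;> linarith
  have hq1 : ρ⁻¹ < 1 := inv_lt_one_of_one_lt₀ hρ
  have hq0 : 0 ≤ ρ⁻¹ := by positivity
  have hgeo := (hasSum_geometric_of_lt_one hq0 hq1).mul_left (2 * (ρ⁻¹ ^ (2 * n) * ρ ^ k))
  have hes : Summable e := Summable.of_norm_bounded hgeo.summable heb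
  have has : Summable (aliasTerm n k) := summable_aliasTerm hn (by simpa using hk)
  have hnorm : ∀ j, ∫ y in Set.Ioc 1 ρ, ‖f j y‖ = aliasTerm n k j - e j := by
    intro j
    rw [← hfint, intervalIntegral.integral_of_le hρ.le]
    refine setIntegral_congr_fun measurableSet_Ioc fun y hy => ?_
    rw [Real.norm_of_nonneg]
    exact sub_nonneg.2 (zpow_le_zpow_right₀ hy.1.le (by omega))
  have key := hasSum_integral_of_summable_integral_norm (μ := volume.restrict (Set.Ioc 1 ρ))
    (F := f) (fun j => (intervalIntegrable_iff_integrableOn_Ioc_of_le hρ.le).1 (hfi j))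
    (by simpa only [hnorm] using has.sub hes)
  have hpt : ∫ y in Set.Ioc 1 ρ, ∑' j, f j y = ∫ y in (1 : ℝ)..ρ, monoKernel n k y := by
    rw [intervalIntegral.integral_of_le hρ.le]
    refine setIntegral_congr_fun measurableSet_Ioc fun y hy => ?_
    exact (hasSum_monoKernel hn k hy.1).tsum_eq
  simp only [← intervalIntegral.integral_of_le hρ.le, hfint] at key
  rw [intervalIntegral.integral_of_le hρ.le, hpt] at key
  rw [← key.tsum_eq, has.tsum_sub hes, sub_sub_cancel_left, abs_neg]
  have h9 := tsum_of_norm_bounded hgeo heb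
  rw [Real.norm_eq_abs] at h9
  refine h9.trans (le_of_eq ?_)
  rw [div_eq_mul_inv]
  ring

theorem abs_integral_monoKernel_sub_le {n : ℕ} (hn : 1 ≤ n) {k : ℤ} (hk : k.natAbs ≤ n) {ρ : ℝ}
    (hρ : 1 < ρ) :
    |(∫ y in (1 : ℝ)..ρ, monoKernel n k y) - ∑' j, aliasTerm n k j| ≤
      2 / (1 - ρ⁻¹) * (ρ⁻¹ ^ (2 * n) * ρ ^ k.natAbs) := by
  have h := abs_integral_monoKernel_sub_le_of_nonneg hn hk hρ
  rcases Int.natAbs_eq k with h1 | h1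
  · rwa [← h1] at h
  · have e1 : ∀ y, monoKernel n k y = -monoKernel n k.natAbs y := fun y => by
      conv_lhs => rw [h1]
      rw [monoKernel, monoKernel, neg_neg]
      ring
    have e2 : ∀ j, aliasTerm n k j = -aliasTerm n k.natAbs j := fun j => by
      conv_lhs => rw [h1]
      rw [aliasTerm, aliasTerm, Int.cast_neg, sub_neg_eq_add, ← sub_eq_add_neg, neg_sub]
    simp only [e1, e2, intervalIntegral.integral_neg, tsum_neg]
    rwa [← neg_sub', abs_neg]

/-! ### Principal values -/

theorem IsPrincipalValue.const_mul {F : ℝ → ℂ} {a c b : ℝ} {J : ℂ}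
    (h : IsPrincipalValue F a c b J) (d : ℂ) :
    IsPrincipalValue (fun x => d * F x) a c b (d * J) := by
  refine ⟨h.1.mono fun ε hε => ⟨hε.1.const_mul d, hε.2.const_mul d⟩, ?_⟩
  simp only [intervalIntegral.integral_const_mul, ← mul_add]
  exact h.2.const_mul d

/-- A principal value at `1` computed by folding `[ρ⁻¹, 1]` onto `[1, ρ]` by `x ↦ x⁻¹`. -/
theorem isPrincipalValue_of_fold {κ : ℝ → ℝ} {P Tp Tm F : ℝ → ℂ} {ρ : ℝ} (hρ : 1 < ρ)
    (hκ : ContinuousOn κ (Set.Ioc 1 ρ)) (hκb : ∀ y ∈ Set.Ioc 1 ρ, |κ y| ≤ 1 / (y - 1))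
    (hP : ContinuousOn P (Set.Icc ρ⁻¹ ρ)) (hTp : ContinuousOn Tp (Set.Icc ρ⁻¹ 1))
    (hTm : ContinuousOn Tm (Set.Icc 1 ρ))
    (hF1 : ∀ x ∈ Set.Ico ρ⁻¹ 1, F x = -(x ^ 2)⁻¹ * (κ x⁻¹ * P x) + Tp x)
    (hF2 : ∀ x ∈ Set.Ioc 1 ρ, F x = κ x * P x - Tm x)
    (hD : IntervalIntegrable (fun y => κ y * (P y - P y⁻¹)) volume 1 ρ) :
    IsPrincipalValue F ρ⁻¹ 1 ρ ((∫ y in (1 : ℝ)..ρ, κ y * (P y - P y⁻¹)) +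
      (∫ x in ρ⁻¹..1, Tp x) - ∫ x in (1 : ℝ)..ρ, Tm x) := by
  have hρ0 : 0 < ρ := by linarith
  have hq0 : 0 < ρ⁻¹ := by positivity
  have hq1 : ρ⁻¹ < 1 := inv_lt_one_of_one_lt₀ hρ
  obtain ⟨C, hC⟩ := isCompact_Icc.exists_bound_of_continuousOn hP
  have hC0 : 0 ≤ C := (norm_nonneg _).trans (hC 1 ⟨hq1.le, hρ.le⟩)
  have hev : ∀ᶠ ε in 𝓝[>] (0 : ℝ), 0 < ε ∧ ε < min (1 / 2) (min (1 - ρ⁻¹) (ρ - 1)) := by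
    have h0 : (0 : ℝ) < min (1 / 2) (min (1 - ρ⁻¹) (ρ - 1)) := by
      refine lt_min (by norm_num) (lt_min (by linarith) (by linarith))
    filter_upwards [Ioo_mem_nhdsGT h0] with ε hε using hε
  have hκC : ContinuousOn (fun y => (κ y : ℂ)) (Set.Ioc 1 ρ) :=
    continuous_ofReal.comp_continuousOn hκ
  have hinv : ContinuousOn (fun y : ℝ => y⁻¹) (Set.Icc ρ⁻¹ ρ) := fun y hy =>
    (continuousAt_inv₀ (hq0.trans_le hy.1).ne').continuousWithinAt
  have hmaps : Set.MapsTo (fun y : ℝ => y⁻¹) (Set.Icc ρ⁻¹ ρ) (Set.Icc ρ⁻¹ ρ) := fun y hy =>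
    ⟨inv_anti₀ (hq0.trans_le hy.1) hy.2, inv_le_of_inv_le₀ hρ0 hy.1⟩
  have hA : ContinuousOn (fun y => κ y * P y) (Set.Ioc 1 ρ) :=
    hκC.mul (hP.mono fun y hy => ⟨by linarith [hy.1], hy.2⟩)
  have hB : ContinuousOn (fun y => κ y * P y⁻¹) (Set.Ioc 1 ρ) :=
    hκC.mul ((hP.comp hinv hmaps).mono fun y hy => ⟨by linarith [hy.1], hy.2⟩)
  have hIA : ∀ {g : ℝ → ℂ}, ContinuousOn g (Set.Ioc 1 ρ) → ∀ {a b : ℝ}, 1 < a → a ≤ b → b ≤ ρ →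
      IntervalIntegrable g volume a b := fun hg a b h1 h2 h3 => by
    refine (hg.mono ?_).intervalIntegrable
    rw [Set.uIcc_of_le h2]
    exact fun y hy => ⟨h1.trans_le hy.1, hy.2.trans h3⟩
  have hITm : ∀ {a b : ℝ}, 1 ≤ a → a ≤ b → b ≤ ρ → IntervalIntegrable Tm volume a b :=
    fun h1 h2 h3 => by
    refine (hTm.mono ?_).intervalIntegrable
    rw [Set.uIcc_of_le h2]
    exact Set.Icc_subset_Icc h1 h3
  have hITp : ∀ {a b : ℝ}, ρ⁻¹ ≤ a → a ≤ b → b ≤ 1 → IntervalIntegrable Tp volume a b :=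
    fun h1 h2 h3 => by
    refine (hTp.mono ?_).intervalIntegrable
    rw [Set.uIcc_of_le h2]
    exact Set.Icc_subset_Icc h1 h3
  have hmain : ∀ ε : ℝ, 0 < ε → ε < min (1 / 2) (min (1 - ρ⁻¹) (ρ - 1)) →
      IntervalIntegrable F volume ρ⁻¹ (1 - ε) ∧ IntervalIntegrable F volume (1 + ε) ρ ∧
      (∫ x in ρ⁻¹..(1 - ε), F x) + ∫ x in (1 + ε)..ρ, F x =
        (∫ y in (1 + ε)..(1 - ε)⁻¹, κ y * P y) + (∫ y in (1 - ε)⁻¹..ρ, κ y * (P y - P y⁻¹)) +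
        (∫ x in ρ⁻¹..(1 - ε), Tp x) - ∫ x in (1 + ε)..ρ, Tm x := by
    intro ε h0 h1
    obtain ⟨h2, h3⟩ := lt_min_iff.1 h1
    obtain ⟨h3, h4⟩ := lt_min_iff.1 h3
    have h5 : 0 < 1 - ε := by linarith
    have h6 : 1 + ε ≤ (1 - ε)⁻¹ := by
      rw [le_inv_comm₀ (by linarith) h5, inv_eq_one_div, le_div_iff₀ (by linarith)]
      nlinarith
    have h7 : (1 - ε)⁻¹ ≤ ρ := inv_le_of_inv_le₀ hρ0 (by linarith)
    have hle : ρ⁻¹ ≤ 1 - ε := by linarith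
    have hsubc : ContinuousOn (fun x : ℝ => (-((x ^ 2)⁻¹ : ℝ) : ℂ) * (κ x⁻¹ * P x))
        (Set.Icc ρ⁻¹ (1 - ε)) := by
      have hm : Set.MapsTo (fun y : ℝ => y⁻¹) (Set.Icc ρ⁻¹ (1 - ε)) (Set.Ioc 1 ρ) := fun y hy =>
        ⟨(one_lt_inv₀ (hq0.trans_le hy.1)).2 (by linarith [hy.2]), inv_le_of_inv_le₀ hρ0 hy.1⟩
      have hs : Set.Icc ρ⁻¹ (1 - ε) ⊆ Set.Icc ρ⁻¹ ρ := Set.Icc_subset_Icc le_rfl (by linarith)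
      refine ContinuousOn.mul ?_ ((hκC.comp (hinv.mono hs) hm).mul (hP.mono hs))
      refine (continuous_ofReal.comp_continuousOn ?_).neg
      exact fun y hy => ((continuousAt_id.pow 2).inv₀
        (pow_ne_zero 2 (hq0.trans_le hy.1).ne')).continuousWithinAt
    have hsubi : IntervalIntegrable (fun x : ℝ => (-((x ^ 2)⁻¹ : ℝ) : ℂ) * (κ x⁻¹ * P x)) volume
        ρ⁻¹ (1 - ε) := by
      refine ContinuousOn.intervalIntegrable ?_
      rwa [Set.uIcc_of_le hle]
    have hE1 : Set.EqOn F (fun x => (-((x ^ 2)⁻¹ : ℝ) : ℂ) * (κ x⁻¹ * P x) + Tp x)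
        (Set.uIcc ρ⁻¹ (1 - ε)) := fun x hx => by
      rw [Set.uIcc_of_le hle] at hx
      rw [hF1 x ⟨hx.1, by linarith [hx.2]⟩]
    have hE2 : Set.EqOn F (fun x => κ x * P x - Tm x) (Set.uIcc (1 + ε) ρ) := fun x hx => by
      rw [Set.uIcc_of_le (by linarith)] at hx
      exact hF2 x ⟨by linarith [hx.1], hx.2⟩
    have hAi := hIA hA (a := 1 + ε) (b := ρ) (by linarith) (by linarith) le_rfl
    have hsubst : ∫ x in ρ⁻¹..(1 - ε), (-((x ^ 2)⁻¹ : ℝ) : ℂ) * (κ x⁻¹ * P x) =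
        -∫ y in (1 - ε)⁻¹..ρ, κ y * P y⁻¹ := by
      have h := intervalIntegral.integral_deriv_smul_comp'' (a := ρ⁻¹) (b := 1 - ε)
        (f := fun x : ℝ => x⁻¹) (f' := fun x : ℝ => -(x ^ 2)⁻¹) (g := fun y => κ y * P y⁻¹)
        ?_ ?_ ?_ ?_
      · rw [inv_inv, intervalIntegral.integral_symm (1 - ε)⁻¹ ρ] at h
        rw [← h]
        refine intervalIntegral.integral_congr fun x _ => ?_
        simp
      · rw [Set.uIcc_of_le hle]
        exact hinv.mono (Set.Icc_subset_Icc le_rfl (by linarith))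
      · intro x hx
        rw [min_eq_left hle] at hx
        exact (hasDerivAt_inv (hq0.trans hx.1).ne').hasDerivWithinAt
      · rw [Set.uIcc_of_le hle]
        exact fun y hy => ((continuousAt_id.pow 2).inv₀
          (pow_ne_zero 2 (hq0.trans_le hy.1).ne')).neg.continuousWithinAt
      · refine hB.mono ?_
        rintro _ ⟨y, hy, rfl⟩
        rw [Set.uIcc_of_le hle] at hy
        exact ⟨(one_lt_inv₀ (hq0.trans_le hy.1)).2 (by linarith [hy.2]),
          inv_le_of_inv_le₀ hρ0 hy.1⟩
    refine ⟨?_, ?_, ?_⟩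
    · refine (hsubi.add (hITp le_rfl hle (by linarith))).congr ?_
      exact fun x hx => (hE1 (Set.uIoc_subset_uIcc hx)).symm
    · refine (hAi.sub (hITm (by linarith) (by linarith) le_rfl)).congr ?_
      exact fun x hx => (hE2 (Set.uIoc_subset_uIcc hx)).symm
    · rw [intervalIntegral.integral_congr hE1, intervalIntegral.integral_congr hE2,
        intervalIntegral.integral_add hsubi (hITp le_rfl hle (by linarith)),
        intervalIntegral.integral_sub hAi (hITm (by linarith) (by linarith) le_rfl), hsubst]
      simp only [mul_sub]
      rw [intervalIntegral.integral_sub (hIA hA (by linarith) h7 le_rfl)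
        (hIA hB (by linarith) h7 le_rfl), ← intervalIntegral.integral_add_adjacent_intervals
        (hIA hA (by linarith) h6 h7) (hIA hA (by linarith) h7 le_rfl)]
      ring
  have ht1 : Tendsto (fun ε : ℝ => 1 - ε) (𝓝[>] 0) (𝓝 1) := by
    have : Tendsto (fun ε : ℝ => 1 - ε) (𝓝 0) (𝓝 (1 - 0)) := by
      exact (continuous_const.sub continuous_id).tendsto 0
    rw [sub_zero] at this
    exact this.mono_left nhdsWithin_le_nhds
  have ht2 : Tendsto (fun ε : ℝ => 1 + ε) (𝓝[>] 0) (𝓝 1) := by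
    have : Tendsto (fun ε : ℝ => 1 + ε) (𝓝 0) (𝓝 (1 + 0)) := by
      exact (continuous_const.add continuous_id).tendsto 0
    rw [add_zero] at this
    exact this.mono_left nhdsWithin_le_nhds
  have ht3 : Tendsto (fun ε : ℝ => (1 - ε)⁻¹) (𝓝[>] 0) (𝓝 1) := by
    simpa using ht1.inv₀ one_ne_zero
  have hbase : ∀ {ε : ℝ}, 0 < ε → ε < min (1 / 2) (min (1 - ρ⁻¹) (ρ - 1)) →
      1 - ε ∈ Set.uIcc ρ⁻¹ 1 ∧ 1 + ε ∈ Set.uIcc 1 ρ ∧ (1 - ε)⁻¹ ∈ Set.uIcc 1 ρ := by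
    intro ε h0 h1
    obtain ⟨h2, h3⟩ := lt_min_iff.1 h1
    obtain ⟨h3, h4⟩ := lt_min_iff.1 h3
    rw [Set.uIcc_of_le hq1.le, Set.uIcc_of_le hρ.le]
    exact ⟨⟨by linarith, by linarith⟩, ⟨by linarith, by linarith⟩,
      ⟨(one_le_inv₀ (by linarith)).2 (by linarith), inv_le_of_inv_le₀ hρ0 (by linarith)⟩⟩
  have hleft : ∀ {g : ℝ → ℂ}, IntervalIntegrable g volume 1 ρ → ∀ {φ : ℝ → ℝ},
      Tendsto φ (𝓝[>] 0) (𝓝 1) → (∀ᶠ ε in 𝓝[>] (0 : ℝ), φ ε ∈ Set.uIcc 1 ρ) →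
      Tendsto (fun ε => ∫ y in (φ ε)..ρ, g y) (𝓝[>] 0) (𝓝 (∫ y in (1 : ℝ)..ρ, g y)) := by
    intro g hg φ h1 h2
    have hc := intervalIntegral.continuousOn_primitive_interval_left
      (((intervalIntegrable_iff' (by finiteness)).1 hg : IntegrableOn g (Set.uIcc 1 ρ)))
    exact (hc 1 Set.left_mem_uIcc).tendsto.comp (tendsto_nhdsWithin_iff.2 ⟨h1, h2⟩)
  refine ⟨hev.mono fun ε hε => ⟨(hmain ε hε.1 hε.2).1, (hmain ε hε.1 hε.2).2.1⟩, ?_⟩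
  have hlim1 : Tendsto (fun ε : ℝ => ∫ y in (1 + ε)..(1 - ε)⁻¹, κ y * P y) (𝓝[>] 0) (𝓝 0) := by
    have hb : Tendsto (fun ε : ℝ => 2 * C * ε) (𝓝[>] 0) (𝓝 0) := by
      have : Tendsto (fun ε : ℝ => 2 * C * ε) (𝓝 0) (𝓝 (2 * C * 0)) :=
        (continuous_const.mul continuous_id).tendsto 0
      rw [mul_zero] at this
      exact this.mono_left nhdsWithin_le_nhds
    refine squeeze_zero_norm' ?_ hb
    filter_upwards [hev] with ε hε
    obtain ⟨h0, h1⟩ := hε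
    obtain ⟨-, -, h7⟩ := hbase h0 h1
    rw [Set.uIcc_of_le hρ.le] at h7
    obtain ⟨h2, -⟩ := lt_min_iff.1 h1
    have h5 : 0 < 1 - ε := by linarith
    have hdiff : (1 - ε)⁻¹ - (1 + ε) = ε ^ 2 * (1 - ε)⁻¹ := by field_simp; ring
    have h8 : (1 - ε)⁻¹ ≤ 2 := inv_le_of_inv_le₀ (by norm_num) (by linarith)
    have h9 : 0 ≤ ε ^ 2 * (1 - ε)⁻¹ := by positivity
    have h6 : 1 + ε ≤ (1 - ε)⁻¹ := by linarith
    have h := intervalIntegral.norm_integral_le_of_norm_le_const (a := 1 + ε) (b := (1 - ε)⁻¹)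
      (C := 1 / ε * C) (f := fun y => κ y * P y) (fun y hy => by
        rw [Set.uIoc_of_le h6] at hy
        have hy1 : 1 + ε < y := hy.1
        have hy2 : y ≤ ρ := hy.2.trans h7.2
        rw [norm_mul, norm_real, Real.norm_eq_abs]
        refine mul_le_mul ((hκb y ⟨by linarith, hy2⟩).trans ?_) (hC y ⟨by linarith, hy2⟩)
          (norm_nonneg _) (by positivity)
        gcongr
        linarith)
    refine h.trans ?_
    rw [hdiff, abs_of_nonneg h9]
    calc 1 / ε * C * (ε ^ 2 * (1 - ε)⁻¹) = C * ε * (1 - ε)⁻¹ := by field_simp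
      _ ≤ C * ε * 2 := by gcongr
      _ = 2 * C * ε := by ring
  have hlim2 := hleft hD ht3 (hev.mono fun ε hε => (hbase hε.1 hε.2).2.2)
  have hlim3 := hleft (hITm le_rfl hρ.le le_rfl) ht2
    (hev.mono fun ε hε => (hbase hε.1 hε.2).2.1)
  have hlim4 : Tendsto (fun ε : ℝ => ∫ x in ρ⁻¹..(1 - ε), Tp x) (𝓝[>] 0)
      (𝓝 (∫ x in ρ⁻¹..1, Tp x)) := by
    have hc := intervalIntegral.continuousOn_primitive_interval
      (((intervalIntegrable_iff' (by finiteness)).1 (hITp le_rfl hq1.le le_rfl) : IntegrableOn Tp (Set.uIcc ρ⁻¹ 1)))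
    exact (hc 1 Set.right_mem_uIcc).tendsto.comp
      (tendsto_nhdsWithin_iff.2 ⟨ht1, hev.mono fun ε hε => (hbase hε.1 hε.2).1⟩)
  have hall := ((hlim1.add hlim2).add hlim4).sub hlim3
  rw [zero_add] at hall
  refine hall.congr' ?_
  filter_upwards [hev] with ε hε using (hmain ε hε.1 hε.2).2.2.symm

/-! ### The function on the cut circle -/

theorem exists_norm_sub_le_of_isLittleO {g : ℂ → ℂ} {a c : ℂ} {β κ : ℝ}
    (h : (fun t : ℂ => g t - (a + c * t ^ ((β : ℝ) : ℂ))) =o[𝓝[sector κ] 0]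
      (fun t : ℂ => ‖t‖ ^ β)) :
    ∃ δ, 0 < δ ∧ ∀ t ∈ sector κ, ‖t‖ ≤ δ → ‖g t - a‖ ≤ (1 + ‖c‖) * ‖t‖ ^ β := by
  have h1 := h.bound one_pos
  rw [eventually_nhdsWithin_iff, Metric.eventually_nhds_iff] at h1
  obtain ⟨δ, hδ, h2⟩ := h1
  refine ⟨δ / 2, half_pos hδ, fun t ht htδ => ?_⟩
  have h3 := h2 (by rw [dist_zero_right]; linarith) ht
  rw [Real.norm_of_nonneg (by positivity), one_mul] at h3
  have h4 : g t - a = (g t - (a + c * t ^ ((β : ℝ) : ℂ))) + c * t ^ ((β : ℝ) : ℂ) := by ring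
  rw [h4, add_mul, one_mul]
  refine (norm_add_le _ _).trans (add_le_add h3 ?_)
  rw [norm_mul, norm_cpow_real]

theorem exp_mem_cutAnnulus {r : ℝ} (hr : 1 < r) {t : ℂ} (ht : t ∈ openRect (Real.log r)) :
    exp (I * t) ∈ cutAnnulus r := by
  have hr0 : 0 < r := by linarith
  have hn : ‖exp (I * t)‖ = Real.exp (-t.im) := by rw [norm_exp]; simp
  obtain ⟨⟨h1, h2⟩, h3, h4⟩ := ht
  refine ⟨⟨?_, ?_⟩, ?_⟩
  · rw [hn, ← Real.exp_log hr0, ← Real.exp_neg, Real.exp_le_exp]; linarith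
  · rw [hn, ← Real.exp_log hr0, Real.exp_le_exp]; linarith
  · rintro ⟨x, hx, hxt⟩
    have hx0 : 0 < x := lt_of_lt_of_le (by positivity) hx.1
    rw [← Real.exp_log hx0, ofReal_exp, exp_eq_exp_iff_exists_int] at hxt
    obtain ⟨k, hk⟩ := hxt
    have him := congrArg Complex.im hk
    simp at him
    have h5 : t.re = (-k : ℤ) * (2 * Real.pi) := by push_cast; linarith
    rw [h5] at h1 h2
    have hpi := Real.two_pi_pos
    have h6 : (0 : ℝ) < (-k : ℤ) := pos_of_mul_pos_left h1 hpi.le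
    have h7 : ((-k : ℤ) : ℝ) < 1 := by
      by_contra hcon
      nlinarith
    have h8 : 0 < -k := by exact_mod_cast h6
    have h9 : -k < 1 := by exact_mod_cast h7
    omega

/-- The values of `u` on the unit circle cut at `1`, as a function of the argument, extended by
the one-sided values `u₀` and `u₁`. -/
noncomputable def circleFun (u : ℂ → ℂ) (u₀ u₁ : ℂ) (t : ℝ) : ℂ :=
  if t ≤ 0 then u₀ else if 2 * Real.pi ≤ t then u₁ else u (exp (I * t))

theorem circleFun_zero (u : ℂ → ℂ) (u₀ u₁ : ℂ) : circleFun u u₀ u₁ 0 = u₀ := if_pos le_rfl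

theorem circleFun_two_pi (u : ℂ → ℂ) (u₀ u₁ : ℂ) : circleFun u u₀ u₁ (2 * Real.pi) = u₁ := by
  rw [circleFun, if_neg (not_le.2 Real.two_pi_pos), if_pos le_rfl]

theorem circleFun_of_mem (u : ℂ → ℂ) (u₀ u₁ : ℂ) {t : ℝ} (ht : t ∈ Set.Ioo 0 (2 * Real.pi)) :
    circleFun u u₀ u₁ t = u (exp (I * t)) := by
  rw [circleFun, if_neg (not_le.2 ht.1), if_neg (not_le.2 ht.2)]

section

variable {u : ℂ → ℂ} {u₀ u₁ : ℂ} {r α κ C δ : ℝ}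

theorem differentiableOn_comp_exp (hr : 1 < r) (hu : AnalyticOnNhd ℂ u (cutAnnulus r)) :
    DifferentiableOn ℂ (fun t => u (exp (I * t))) (openRect (Real.log r)) := fun t ht =>
  ((hu _ (exp_mem_cutAnnulus hr ht)).differentiableAt.comp t
    (by fun_prop : DifferentiableAt ℂ (fun t => exp (I * t)) t)).differentiableWithinAt

theorem ofReal_mem_sector (hκ : 0 < κ) {t : ℝ} (ht : 0 < t) : (t : ℂ) ∈ sector κ := by
  simp only [sector, Set.mem_ofPred_eq, ofReal_im, abs_zero, ofReal_re]
  positivity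

theorem continuous_circleFun (hr : 1 < r) (hα : 1 < α) (hκ : 0 < κ) (hC : 0 ≤ C) (hδ : 0 < δ)
    (hu : AnalyticOnNhd ℂ u (cutAnnulus r))
    (h₀ : ∀ t ∈ sector κ, ‖t‖ ≤ δ → ‖u (exp (I * t)) - u₀‖ ≤ C * ‖t‖ ^ (α - 1))
    (h₁ : ∀ t ∈ sector κ, ‖t‖ ≤ δ →
      ‖u (exp (I * (2 * Real.pi - t))) - u₁‖ ≤ C * ‖t‖ ^ (α - 1)) :
    Continuous (circleFun u u₀ u₁) := by
  have hpi := Real.pi_gt_three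
  have hlim : ∀ s : ℝ, Tendsto (fun t : ℝ => C * |t - s| ^ (α - 1)) (𝓝 s) (𝓝 0) := by
    intro s
    have hcont : Continuous fun t : ℝ => C * |t - s| ^ (α - 1) :=
      continuous_const.mul ((continuous_abs.comp (continuous_id.sub continuous_const)).rpow_const
        fun _ => Or.inr (by linarith))
    have := hcont.tendsto s
    rwa [sub_self, abs_zero, Real.zero_rpow (by linarith), mul_zero] at this
  rw [continuous_iff_continuousAt]
  intro s
  rcases lt_trichotomy s 0 with hs | rfl | hs
  · refine continuousAt_const.congr (f := fun _ => u₀) ?_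
    filter_upwards [Iio_mem_nhds hs] with t ht
    exact (if_pos (le_of_lt ht)).symm
  · rw [ContinuousAt, circleFun_zero, tendsto_iff_norm_sub_tendsto_zero]
    refine squeeze_zero' (Eventually.of_forall fun _ => norm_nonneg _) ?_ (hlim 0)
    filter_upwards [Metric.ball_mem_nhds (0 : ℝ) (lt_min hδ one_pos)] with t ht
    rw [Metric.mem_ball, dist_zero_right, Real.norm_eq_abs, lt_min_iff] at ht
    rw [sub_zero]
    rcases le_or_gt t 0 with h | h
    · rw [circleFun, if_pos h, sub_self, norm_zero]; positivity
    · rw [circleFun_of_mem _ _ _ ⟨h, by linarith [le_abs_self t]⟩]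
      have := h₀ t (ofReal_mem_sector hκ h) (by rw [norm_real, Real.norm_eq_abs]; exact ht.1.le)
      rwa [norm_real, Real.norm_eq_abs] at this
  rcases lt_trichotomy s (2 * Real.pi) with hs2 | rfl | hs2
  · have hmem : (s : ℂ) ∈ openRect (Real.log r) :=
      ⟨⟨hs, hs2⟩, by simp [Real.log_pos hr]⟩
    have h1 : ContinuousAt (fun t : ℝ => u (exp (I * t))) s :=
      ((differentiableOn_comp_exp hr hu).continuousOn.continuousAt
        ((isOpen_openRect _).mem_nhds hmem)).comp continuous_ofReal.continuousAt
    refine h1.congr ?_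
    filter_upwards [Ioo_mem_nhds hs hs2] with t ht
    exact (circleFun_of_mem _ _ _ ht).symm
  · rw [ContinuousAt, circleFun_two_pi, tendsto_iff_norm_sub_tendsto_zero]
    refine squeeze_zero' (Eventually.of_forall fun _ => norm_nonneg _) ?_ (hlim (2 * Real.pi))
    filter_upwards [Metric.ball_mem_nhds (2 * Real.pi : ℝ) (lt_min hδ one_pos)] with t ht
    rw [Metric.mem_ball, Real.dist_eq, lt_min_iff] at ht
    rcases le_or_gt (2 * Real.pi) t with h | h
    · rw [circleFun, if_neg (by linarith), if_pos h, sub_self, norm_zero]; positivity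
    · rw [circleFun_of_mem _ _ _ ⟨by linarith [neg_abs_le (t - 2 * Real.pi)], h⟩]
      have hn : ‖((2 * Real.pi - t : ℝ) : ℂ)‖ = |t - 2 * Real.pi| := by
        rw [norm_real, Real.norm_eq_abs, abs_sub_comm]
      have := h₁ _ (ofReal_mem_sector hκ (sub_pos.2 h)) (by rw [hn]; exact ht.1.le)
      rw [hn] at this
      push_cast at this
      rwa [sub_sub_cancel] at this
  · refine continuousAt_const.congr (f := fun _ => u₁) ?_
    filter_upwards [Ioi_mem_nhds hs2] with t ht
    have ht' : 2 * Real.pi < t := ht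
    rw [circleFun, if_neg (by linarith), if_pos ht'.le]

theorem integral_mul_circleFun (g : ℝ → ℂ) :
    ∫ t in (0 : ℝ)..(2 * Real.pi), g t * circleFun u u₀ u₁ t =
      ∫ t in (0 : ℝ)..(2 * Real.pi), g t * u (exp (I * t)) :=
  intervalIntegral.integral_congr_Ioo_of_le Real.two_pi_pos.le fun t ht => by
    simp only [circleFun_of_mem _ _ _ ht]

theorem intervalIntegrable_mul_comp_exp (hc : Continuous (circleFun u u₀ u₁)) {g : ℝ → ℂ}
    (hg : Continuous g) :
    IntervalIntegrable (fun t : ℝ => g t * u (exp (I * t))) volume 0 (2 * Real.pi) := by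
  have h := (hg.mul hc).intervalIntegrable (μ := volume) 0 (2 * Real.pi)
  refine h.congr_ae ?_
  rw [Set.uIoc_of_le Real.two_pi_pos.le, ← restrict_Ioo_eq_restrict_Ioc]
  exact (ae_restrict_iff' measurableSet_Ioo).2 (ae_of_all _ fun t ht => by
    simp only [Pi.mul_apply, circleFun_of_mem _ _ _ ht])

theorem circleFun_decay (hr : 1 < r) (hα : 1 < α) (hκ : 0 < κ) (hC : 0 ≤ C) (hδ : 0 < δ)
    (hu : AnalyticOnNhd ℂ u (cutAnnulus r))
    (h₀ : ∀ t ∈ sector κ, ‖t‖ ≤ δ → ‖u (exp (I * t)) - u₀‖ ≤ C * ‖t‖ ^ (α - 1))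
    (h₁ : ∀ t ∈ sector κ, ‖t‖ ≤ δ →
      ‖u (exp (I * (2 * Real.pi - t))) - u₁‖ ≤ C * ‖t‖ ^ (α - 1)) :
    ∃ C', 0 ≤ C' ∧ ∀ᶠ m : ℕ in atTop, ∀ s : ℤ, s.natAbs = m →
      ‖(∫ t in (0 : ℝ)..(2 * Real.pi), exp (-(s * t * I)) * circleFun u u₀ u₁ t) -
        (u₁ - u₀) * (I / s)‖ ≤ C' * (m : ℝ) ^ (-α) := by
  have hL := Real.log_pos hr
  have hcont := continuous_circleFun hr hα hκ hC hδ hu h₀ h₁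
  have hd := differentiableOn_comp_exp hr hu
  have hint : IntervalIntegrable (fun t : ℝ => u (exp (I * t))) volume 0 (2 * Real.pi) := by
    simpa using intervalIntegrable_mul_comp_exp hcont (g := fun _ => 1) continuous_const
  obtain ⟨C₁, hC₁, hm₁⟩ := fourier_decay_of_sector hα hκ hL hδ hC hd hint h₀ h₁
  have hd2 : DifferentiableOn ℂ (fun t => u (exp (I * (2 * Real.pi - t))))
      (openRect (Real.log r)) := by
    refine hd.comp (t := openRect (Real.log r)) (f := fun t : ℂ => 2 * Real.pi - t)
      (by fun_prop) ?_
    rintro t ⟨⟨h1, h2⟩, h3, h4⟩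
    refine ⟨⟨?_, ?_⟩, ?_, ?_⟩ <;> simp <;> linarith
  have hint2 : IntervalIntegrable (fun t : ℝ => u (exp (I * (2 * Real.pi - t)))) volume 0
      (2 * Real.pi) := by
    have h := (hint.comp_sub_left (2 * Real.pi)).symm
    simpa using h
  obtain ⟨C₂, hC₂, hm₂⟩ := fourier_decay_of_sector hα hκ hL hδ hC hd2 hint2 h₁
    (by simpa only [sub_sub_cancel] using h₀)
  refine ⟨C₁ + C₂, by positivity, ?_⟩
  filter_upwards [hm₁, hm₂] with m h1 h2 s hs
  rw [add_mul]
  rw [integral_mul_circleFun (fun t : ℝ => exp (-(s * t * I)))]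
  rcases Int.natAbs_eq s with h | h
  · rw [hs] at h
    subst h
    refine le_trans ?_ (h1.trans (le_add_of_nonneg_right (by positivity)))
    simp only [Int.cast_natCast, le_refl]
  · rw [hs] at h
    subst h
    refine le_trans ?_ (h2.trans (le_add_of_nonneg_left (by positivity)))
    have hsub := intervalIntegral.integral_comp_sub_left (a := 0) (b := 2 * Real.pi)
      (fun t : ℝ => exp (-(((-(m : ℤ) : ℤ) : ℂ) * t * I)) * u (exp (I * t))) (2 * Real.pi)
    rw [sub_self, sub_zero] at hsub
    rw [← hsub]
    have he : ∀ t : ℝ, exp (-(((-(m : ℤ) : ℤ) : ℂ) * ((2 * Real.pi - t : ℝ) : ℂ) * I)) =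
        exp (-(m * t * I)) := by
      intro t
      have := exp_int_mul_two_pi (m : ℤ)
      rw [← mul_one (exp (-(m * t * I))), ← this, ← exp_add]
      congr 1
      push_cast
      ring
    simp only [he]
    push_cast
    rw [div_neg, mul_neg, sub_neg_eq_add]
    refine le_of_eq ?_
    congr 1
    ring

end

/-! ### The principal value of the correction term -/

/-- `y⁻ⁿ / (yⁿ - y⁻ⁿ) / y`. -/
noncomputable def foldKernel (n : ℕ) (y : ℝ) : ℝ := y ^ (-n : ℤ) / (y ^ n - y ^ (-n : ℤ)) / y

theorem continuousOn_foldKernel {n : ℕ} (hn : 1 ≤ n) (ρ : ℝ) :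
    ContinuousOn (foldKernel n) (Set.Ioc 1 ρ) := by
  intro y hy
  have hy0 : y ≠ 0 := by linarith [hy.1]
  have hd : y ^ n - y ^ (-n : ℤ) ≠ 0 := by
    have := sub_one_le_pow_sub hn hy.1.le; linarith [hy.1]
  have hz : ∀ m : ℤ, ContinuousAt (fun y : ℝ => y ^ m) y := fun m =>
    continuousAt_zpow₀ y m (Or.inl hy0)
  exact (((hz _).div ((continuousAt_id.pow n).sub (hz _)) hd).div
    continuousAt_id hy0).continuousWithinAt

theorem abs_foldKernel_le {n : ℕ} (hn : 1 ≤ n) {y : ℝ} (hy : 1 < y) :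
    |foldKernel n y| ≤ 1 / (y - 1) := by
  have hy0 : 0 < y := by linarith
  have h1 := sub_one_le_pow_sub hn hy.le
  have hd : 0 < y ^ n - y ^ (-n : ℤ) := by linarith
  have h3 : y ^ (-n : ℤ) ≤ 1 := zpow_le_one_of_nonpos₀ hy.le (by omega)
  have h4 : 0 < y ^ (-n : ℤ) := zpow_pos hy0 _
  rw [foldKernel, abs_of_pos (by positivity)]
  refine (div_le_self (by positivity) hy.le).trans ?_
  exact div_le_div₀ zero_le_one h3 (by linarith) h1

theorem foldKernel_mul_sub (K : ℂ → ℂ) {n : ℕ} (hn : 1 ≤ n) (y : ℝ) :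
    (foldKernel n y : ℂ) * (laurentMid K n y - laurentMid K n (y⁻¹ : ℝ)) =
      ∑ k ∈ Finset.Icc (-n : ℤ) n, midCoeff K n k * (monoKernel n k y : ℂ) := by
  rw [laurentMid_eq_sum K hn, laurentMid_eq_sum K hn, ← Finset.sum_sub_distrib, Finset.mul_sum]
  refine Finset.sum_congr rfl fun k _ => ?_
  rw [foldKernel, monoKernel]
  push_cast
  rw [inv_zpow, ← zpow_neg]
  ring

theorem correctionKernel_of_lt_one {K : ℂ → ℂ} {n : ℕ} (hn : 1 ≤ n) {x : ℝ} (hx0 : 0 < x)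
    (hx1 : x < 1) (hK : K x = laurentMid K n x + laurentPlus K n x + laurentMinus K n x) :
    correctionKernel K n x / x = -(((x ^ 2 : ℝ)⁻¹ : ℝ) : ℂ) * (foldKernel n x⁻¹ * laurentMid K n x)
      + laurentPlus K n x / x := by
  have hxc : (x : ℂ) ≠ 0 := by exact_mod_cast hx0.ne'
  have hd : (x⁻¹ ^ n - x⁻¹ ^ (-n : ℤ) : ℝ) ≠ 0 := by
    have h1 : 1 < x⁻¹ := (one_lt_inv₀ hx0).2 hx1
    have := sub_one_le_pow_sub hn h1.le
    linarith
  have hd' : ((x : ℂ) ^ n)⁻¹ - (x : ℂ) ^ n ≠ 0 := by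
    rw [zpow_neg, zpow_natCast, inv_pow, inv_inv] at hd
    exact_mod_cast hd
  have hd2 : (x : ℂ) ^ n - ((x : ℂ) ^ n)⁻¹ ≠ 0 := by
    rw [← neg_sub]; exact neg_ne_zero.2 hd'
  rw [correctionKernel, powMinus, if_neg (by
    rw [norm_real, Real.norm_of_nonneg hx0.le]; linarith), hK, foldKernel]
  push_cast
  simp only [zpow_neg, zpow_natCast, inv_pow, inv_inv]
  have e : (x : ℂ) ^ n / (((x : ℂ) ^ n)⁻¹ - (x : ℂ) ^ n) =
      -((x : ℂ) ^ n / ((x : ℂ) ^ n - ((x : ℂ) ^ n)⁻¹)) := by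
    rw [← neg_sub, div_neg]
  rw [e]
  have num : (x : ℂ) ^ n * (laurentMid K n x + laurentPlus K n x + laurentMinus K n x) -
      ((x : ℂ) ^ n)⁻¹ * laurentPlus K n x - (x : ℂ) ^ n * laurentMinus K n x =
      (x : ℂ) ^ n * laurentMid K n x + ((x : ℂ) ^ n - ((x : ℂ) ^ n)⁻¹) * laurentPlus K n x := by
    ring
  rw [num]
  generalize (x : ℂ) ^ n - ((x : ℂ) ^ n)⁻¹ = D at *
  field_simp

theorem correctionKernel_of_one_lt {K : ℂ → ℂ} {n : ℕ} (hn : 1 ≤ n) {x : ℝ} (hx1 : 1 < x)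
    (hK : K x = laurentMid K n x + laurentPlus K n x + laurentMinus K n x) :
    correctionKernel K n x / x = foldKernel n x * laurentMid K n x - laurentMinus K n x / x := by
  have hx0 : 0 < x := by linarith
  have hxc : (x : ℂ) ≠ 0 := by exact_mod_cast hx0.ne'
  have hd : (x ^ n - x ^ (-n : ℤ) : ℝ) ≠ 0 := by
    have := sub_one_le_pow_sub hn hx1.le
    linarith
  have hd' : (x : ℂ) ^ n - (x : ℂ) ^ (-n : ℤ) ≠ 0 := by exact_mod_cast hd
  rw [correctionKernel, powMinus, if_pos (by
    rw [norm_real, Real.norm_of_nonneg hx0.le]; exact hx1.le), hK, foldKernel]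
  push_cast
  have num : (x : ℂ) ^ (-n : ℤ) * (laurentMid K n x + laurentPlus K n x + laurentMinus K n x) -
      (x : ℂ) ^ (-n : ℤ) * laurentPlus K n x - (x : ℂ) ^ n * laurentMinus K n x =
      (x : ℂ) ^ (-n : ℤ) * laurentMid K n x -
        ((x : ℂ) ^ n - (x : ℂ) ^ (-n : ℤ)) * laurentMinus K n x := by
    ring
  rw [num]
  generalize (x : ℂ) ^ n - (x : ℂ) ^ (-n : ℤ) = D at *
  field_simp

/-! ### The error estimate -/

theorem exists_laurent_bound {K : ℂ → ℂ} {ρ : ℝ} (hρ : 1 < ρ)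
    (hK : AnalyticOnNhd ℂ K (annulus ρ)) :
    ∃ M q : ℝ, 0 ≤ M ∧ 0 < q ∧ q * ρ < 1 ∧ (∀ m, ‖laurentCoeff K m‖ ≤ M * q ^ m.natAbs) ∧
      ∀ z ∈ annulus ρ, HasSum (fun m : ℤ => laurentCoeff K m * z ^ m) (K z) := by
  obtain ⟨R, hR, hKR⟩ := exists_analyticOnNhd_annulus hρ.le hK
  have hR1 : 1 ≤ R := by linarith
  have hR0 : 0 < R := by linarith
  obtain ⟨M, hM0, hM⟩ := exists_norm_laurentCoeff_le hR1 hKR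
  refine ⟨M, R⁻¹, hM0, by positivity, ?_, hM, fun z hz => ?_⟩
  · rw [inv_mul_lt_iff₀ hR0]; linarith
  · exact hasSum_laurent hR1 hKR ((inv_strictAnti₀ (by linarith) hR).trans_le hz.1)
      (hz.2.trans_lt hR)

section

variable {K : ℂ → ℂ} {M q ρ : ℝ}

theorem norm_laurentPlus_le (hc : ∀ m, ‖laurentCoeff K m‖ ≤ M * q ^ m.natAbs) (hq0 : 0 ≤ q)
    (hq1 : q < 1) (n : ℕ) {z : ℂ} (hz : ‖z‖ ≤ 1) :
    ‖laurentPlus K n z‖ ≤ M / (1 - q) * q ^ n := by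
  rw [laurentPlus_eq_halfTail]
  exact norm_halfTail_le (fun k => by simpa using hc k) hq0 hq1 n hz

theorem norm_laurentMinus_le (hc : ∀ m, ‖laurentCoeff K m‖ ≤ M * q ^ m.natAbs) (hq0 : 0 ≤ q)
    (hq1 : q < 1) (n : ℕ) {z : ℂ} (hz : 1 ≤ ‖z‖) :
    ‖laurentMinus K n z‖ ≤ M / (1 - q) * q ^ n := by
  rw [laurentMinus_eq_halfTail]
  exact norm_halfTail_le (fun k => by simpa using hc (-k)) hq0 hq1 n
    (by rw [norm_inv]; exact inv_le_one_of_one_le₀ hz)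

theorem continuousOn_laurentPlus (hc : ∀ m, ‖laurentCoeff K m‖ ≤ M * q ^ m.natAbs) (hq0 : 0 ≤ q)
    (hq1 : q < 1) (n : ℕ) : ContinuousOn (laurentPlus K n) (Metric.closedBall 0 1) := by
  rw [funext (laurentPlus_eq_halfTail K n)]
  exact continuousOn_halfTail (fun k => by simpa using hc k) hq0 zero_le_one (by simpa using hq1) n

theorem continuousOn_laurentMinus (hc : ∀ m, ‖laurentCoeff K m‖ ≤ M * q ^ m.natAbs) (hq0 : 0 ≤ q)
    (hq1 : q < 1) (n : ℕ) : ContinuousOn (laurentMinus K n) {z | 1 ≤ ‖z‖} := by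
  rw [funext (laurentMinus_eq_halfTail K n)]
  refine (continuousOn_halfTail (a := fun k => laurentCoeff K (-k)) (fun k => by simpa using hc (-k))
    hq0 zero_le_one (by simpa using hq1) n).comp (f := fun z : ℂ => z⁻¹) ?_ ?_
  · intro z hz
    have hz' : 1 ≤ ‖z‖ := hz
    exact (continuousAt_inv₀ (norm_pos_iff.1 (by linarith))).continuousWithinAt
  · intro z hz
    have hz' : 1 ≤ ‖z‖ := hz
    rw [mem_closedBall_zero_iff, norm_inv]
    exact inv_le_one_of_one_le₀ hz'

theorem continuousOn_laurentMid (K : ℂ → ℂ) {n : ℕ} (hn : 1 ≤ n) :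
    ContinuousOn (laurentMid K n) {0}ᶜ := by
  rw [funext (laurentMid_eq_sum K hn)]
  refine continuousOn_finsetSum _ fun k _ => ?_
  exact continuousOn_const.mul fun z hz => (continuousAt_zpow₀ z k (Or.inl hz)).continuousWithinAt

theorem isPrincipalValue_correctionKernel (hρ : 1 < ρ)
    (hc : ∀ m, ‖laurentCoeff K m‖ ≤ M * q ^ m.natAbs) (hq0 : 0 ≤ q) (hq1 : q < 1)
    (hK : ∀ z ∈ annulus ρ, HasSum (fun m : ℤ => laurentCoeff K m * z ^ m) (K z))
    {n : ℕ} (hn : 1 ≤ n) :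
    IsPrincipalValue (fun x : ℝ => correctionKernel K n x / x) ρ⁻¹ 1 ρ
      ((∑ k ∈ Finset.Icc (-n : ℤ) n,
          midCoeff K n k * ((∫ y in (1 : ℝ)..ρ, monoKernel n k y : ℝ) : ℂ)) +
        (∫ x in ρ⁻¹..1, laurentPlus K n x / x) - ∫ x in (1 : ℝ)..ρ, laurentMinus K n x / x) := by
  have hρ0 : 0 < ρ := by linarith
  have hρi : 0 < ρ⁻¹ := by positivity
  have hρ1 : ρ⁻¹ < 1 := inv_lt_one_of_one_lt₀ hρ
  have hann : ∀ x : ℝ, ρ⁻¹ ≤ x → x ≤ ρ → (x : ℂ) ∈ annulus ρ := fun x h1 h2 => by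
    rw [annulus, Set.mem_ofPred_eq, norm_real, Real.norm_of_nonneg (hρi.le.trans h1)]
    exact ⟨h1, h2⟩
  have hmono : ∀ k ∈ Finset.Icc (-n : ℤ) n, IntervalIntegrable
      (fun y => midCoeff K n k * (monoKernel n k y : ℂ)) volume 1 ρ := fun k hk => by
    have hk' : k.natAbs ≤ n := by rw [Finset.mem_Icc] at hk; omega
    have h := intervalIntegrable_monoKernel hn hk' hρ
    exact IntervalIntegrable.const_mul ⟨Integrable.ofReal h.1, Integrable.ofReal h.2⟩ _
  have key := isPrincipalValue_of_fold (κ := foldKernel n)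
    (P := fun x : ℝ => laurentMid K n x) (Tp := fun x : ℝ => laurentPlus K n x / x)
    (Tm := fun x : ℝ => laurentMinus K n x / x)
    (F := fun x : ℝ => correctionKernel K n x / x) hρ (continuousOn_foldKernel hn ρ)
    (fun y hy => abs_foldKernel_le hn hy.1) ?_ ?_ ?_ ?_ ?_ ?_
  · simp only [foldKernel_mul_sub K hn] at key
    rw [intervalIntegral.integral_finsetSum hmono] at key
    simpa only [intervalIntegral.integral_const_mul, intervalIntegral.integral_ofReal] using key
  · refine (continuousOn_laurentMid K hn).comp continuous_ofReal.continuousOn fun x hx => ?_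
    have : x ≠ 0 := (hρi.trans_le hx.1).ne'
    simpa using this
  · refine ContinuousOn.div ((continuousOn_laurentPlus hc hq0 hq1 n).comp
      continuous_ofReal.continuousOn fun x hx => ?_) continuous_ofReal.continuousOn fun x hx => ?_
    · rw [mem_closedBall_zero_iff, norm_real, Real.norm_of_nonneg (hρi.le.trans hx.1)]
      exact hx.2
    · exact_mod_cast (hρi.trans_le hx.1).ne'
  · refine ContinuousOn.div ((continuousOn_laurentMinus hc hq0 hq1 n).comp
      continuous_ofReal.continuousOn fun x hx => ?_) continuous_ofReal.continuousOn fun x hx => ?_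
    · rw [Set.mem_ofPred_eq, norm_real, Real.norm_of_nonneg (zero_le_one.trans hx.1)]
      exact hx.1
    · exact_mod_cast (zero_lt_one.trans_le hx.1).ne'
  · intro x hx
    have h := correctionKernel_of_lt_one hn (hρi.trans_le hx.1) hx.2
      (eq_laurentMid_add hn (hK _ (hann x hx.1 (by linarith [hx.2]))))
    simp only [h, ofReal_inv, ofReal_pow]
  · intro x hx
    exact correctionKernel_of_one_lt hn hx.1
      (eq_laurentMid_add hn (hK _ (hann x (by linarith [hx.1]) hx.2)))
  · simp only [foldKernel_mul_sub K hn]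
    have h := IntervalIntegrable.sum _ hmono
    rwa [Finset.sum_fn] at h

theorem norm_integral_laurentPlus_le (hρ : 1 < ρ)
    (hc : ∀ m, ‖laurentCoeff K m‖ ≤ M * q ^ m.natAbs) (hM : 0 ≤ M) (hq0 : 0 ≤ q) (hq1 : q < 1)
    (n : ℕ) :
    ‖∫ x in ρ⁻¹..1, laurentPlus K n x / x‖ ≤ M / (1 - q) * ρ * q ^ n := by
  have hρi : 0 < ρ⁻¹ := by positivity
  have hρ1 : ρ⁻¹ < 1 := inv_lt_one_of_one_lt₀ hρ
  have h1q : 0 < 1 - q := by linarith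
  have h := intervalIntegral.norm_integral_le_of_norm_le_const (a := ρ⁻¹) (b := 1)
    (f := fun x : ℝ => laurentPlus K n x / x) (C := M / (1 - q) * q ^ n * ρ) (fun x hx => by
      rw [Set.uIoc_of_le hρ1.le] at hx
      have hx0 : 0 < x := hρi.trans hx.1
      have hxn : ‖(x : ℂ)‖ = x := by rw [norm_real, Real.norm_of_nonneg hx0.le]
      rw [norm_div, div_eq_mul_inv, hxn]
      refine mul_le_mul (norm_laurentPlus_le hc hq0 hq1 n (hxn.le.trans hx.2))
        (inv_le_of_inv_le₀ (by linarith) hx.1.le) (by positivity) (by positivity))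
  refine h.trans ?_
  rw [abs_of_pos (by linarith)]
  calc M / (1 - q) * q ^ n * ρ * (1 - ρ⁻¹) ≤ M / (1 - q) * q ^ n * ρ * 1 := by
        gcongr; linarith
    _ = _ := by ring

theorem norm_integral_laurentMinus_le (hρ : 1 < ρ)
    (hc : ∀ m, ‖laurentCoeff K m‖ ≤ M * q ^ m.natAbs) (hM : 0 ≤ M) (hq0 : 0 ≤ q) (hq1 : q < 1)
    (n : ℕ) :
    ‖∫ x in (1 : ℝ)..ρ, laurentMinus K n x / x‖ ≤ M / (1 - q) * ρ * q ^ n := by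
  have h1q : 0 < 1 - q := by linarith
  have h := intervalIntegral.norm_integral_le_of_norm_le_const (a := 1) (b := ρ)
    (f := fun x : ℝ => laurentMinus K n x / x) (C := M / (1 - q) * q ^ n) (fun x hx => by
      rw [Set.uIoc_of_le hρ.le] at hx
      have hxn : ‖(x : ℂ)‖ = x := by rw [norm_real, Real.norm_of_nonneg (by linarith [hx.1])]
      rw [norm_div, hxn]
      exact (div_le_self (norm_nonneg _) hx.1.le).trans
        (norm_laurentMinus_le hc hq0 hq1 n (hx.1.le.trans hxn.ge)))
  refine h.trans ?_
  rw [abs_of_pos (by linarith)]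
  calc M / (1 - q) * q ^ n * (ρ - 1) ≤ M / (1 - q) * q ^ n * ρ := by gcongr; linarith
    _ = _ := by ring

theorem exists_pow_le_rpow {α : ℝ} (hα : 0 < α) (hq0 : 0 < q) (hq1 : q < 1) :
    ∃ B, 0 ≤ B ∧ ∀ n : ℕ, 1 ≤ n → q ^ n ≤ B * (n : ℝ) ^ (-α) := by
  obtain ⟨B, hB0, hB⟩ := exists_exp_neg_le_rpow hα (neg_pos.2 (Real.log_neg hq0 hq1))
  refine ⟨B, hB0, fun n hn => ?_⟩
  have h := hB n (by exact_mod_cast hn)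
  rwa [neg_mul, neg_neg, ← Real.rpow_def_of_pos hq0, Real.rpow_natCast] at h

theorem sum_norm_midCoeff_mul_le (hc : ∀ m, ‖laurentCoeff K m‖ ≤ M * q ^ m.natAbs) (hq0 : 0 ≤ q)
    (hρ : 0 ≤ ρ) (hqρ : q * ρ < 1) (n : ℕ) (s : Finset ℤ) :
    ∑ k ∈ s, ‖midCoeff K n k‖ * ρ ^ k.natAbs ≤ ∑' k : ℤ, M * (q * ρ) ^ k.natAbs := by
  have hM : 0 ≤ M := by simpa using (norm_nonneg _).trans (hc 0)
  have hs := (summable_pow_natAbs (mul_nonneg hq0 hρ) hqρ).mul_left M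
  refine (Finset.sum_le_sum fun k _ => ?_).trans (hs.sum_le_tsum s fun k _ => by positivity)
  rw [mul_pow, ← mul_assoc]
  have := (norm_midCoeff_le K n k).trans (hc k)
  gcongr

theorem trapErr_laurentMid_mul {w : ℝ → ℂ} (hw : Continuous w) {n : ℕ} (hn : 1 ≤ n) :
    trapErr n (fun t => laurentMid K n (exp (t * I)) * w t) =
      ∑ k ∈ Finset.Icc (-n : ℤ) n, midCoeff K n k * trapErr n (fun t => exp (k * t * I) * w t) := by
  simp only [laurentMid_eq_sum K hn, Finset.sum_mul]
  rw [trapErr_sum]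
  · refine Finset.sum_congr rfl fun k _ => ?_
    rw [← trapErr_const_mul]
    congr 1
    ext t
    rw [← exp_int_mul, mul_assoc, mul_assoc]
  · intro k _
    refine Continuous.intervalIntegrable ?_ _ _
    have : ∀ t : ℝ, exp (t * I) ^ k = exp (k * (t * I)) := fun t => (exp_int_mul _ _).symm
    simp only [this]
    fun_prop

/-- The error of the modified trapezoidal rule, up to the correction term and `O(n⁻ᵅ)`. -/
theorem exists_norm_trapErr_laurentMid_sub_le {w : ℝ → ℂ} (hw : Continuous w) {α : ℝ} (hα : 1 < α)
    {u₀ u₁ : ℂ} (hw0 : w 0 = u₀) (hw1 : w (2 * Real.pi) = u₁)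
    (hdecay : ∃ C, 0 ≤ C ∧ ∀ᶠ m : ℕ in atTop, ∀ s : ℤ, s.natAbs = m →
      ‖(∫ t in (0 : ℝ)..(2 * Real.pi), exp (-(s * t * I)) * w t) -
        (u₁ - u₀) * (I / s)‖ ≤ C * (m : ℝ) ^ (-α))
    (hρ : 1 < ρ) (hc : ∀ m, ‖laurentCoeff K m‖ ≤ M * q ^ m.natAbs) (hq0 : 0 < q)
    (hqρ : q * ρ < 1) :
    ∃ C, 0 ≤ C ∧ ∀ᶠ n : ℕ in atTop,
      ‖trapErr n (fun t => laurentMid K n (exp (t * I)) * w t) -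
        (u₁ - u₀) * I * ∑ k ∈ Finset.Icc (-n : ℤ) n,
          midCoeff K n k * ((∫ y in (1 : ℝ)..ρ, monoKernel n k y : ℝ) : ℂ)‖ ≤
      C * (n : ℝ) ^ (-α) := by
  have hM : 0 ≤ M := by simpa using (norm_nonneg _).trans (hc 0)
  have hρ1 : ρ⁻¹ < 1 := inv_lt_one_of_one_lt₀ hρ
  have hρ0 : 0 < ρ := by linarith
  have hq1 : q < 1 := by nlinarith
  subst hw0 hw1
  obtain ⟨C₁, hC₁, h₁⟩ := exists_norm_trapErr_sub_le hw hα hdecay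
  obtain ⟨B, hB0, hB⟩ := exists_pow_le_rpow (q := ρ⁻¹) (α := α) (by linarith) (by positivity) hρ1
  set S₁ := ∑' k : ℤ, M * (q * 1) ^ k.natAbs with hS₁
  set S₂ := ∑' k : ℤ, M * (q * ρ) ^ k.natAbs with hS₂
  set D := ‖(w (2 * Real.pi) - w 0) * I‖ with hD
  have hS₁0 : 0 ≤ S₁ := tsum_nonneg fun k => by positivity
  have hS₂0 : 0 ≤ S₂ := tsum_nonneg fun k => by positivity
  have h1ρ : 0 < 1 - ρ⁻¹ := by linarith
  refine ⟨S₁ * C₁ + D * (2 / (1 - ρ⁻¹)) * B * S₂, by positivity, ?_⟩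
  filter_upwards [h₁, eventually_ge_atTop 1] with n hn1 hn
  rw [trapErr_laurentMid_mul hw hn, Finset.mul_sum, ← Finset.sum_sub_distrib]
  have hmem : ∀ k ∈ Finset.Icc (-n : ℤ) n, k.natAbs ≤ n := fun k hk => by
    rw [Finset.mem_Icc] at hk; omega
  have hterm : ∀ k ∈ Finset.Icc (-n : ℤ) n,
      ‖midCoeff K n k * trapErr n (fun t => exp (k * t * I) * w t) -
        (w (2 * Real.pi) - w 0) * I *
          (midCoeff K n k * ((∫ y in (1 : ℝ)..ρ, monoKernel n k y : ℝ) : ℂ))‖ ≤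
      (‖midCoeff K n k‖ * 1 ^ k.natAbs) * (C₁ * (n : ℝ) ^ (-α)) +
        (‖midCoeff K n k‖ * ρ ^ k.natAbs) * (D * (2 / (1 - ρ⁻¹)) * (B * (n : ℝ) ^ (-α))) := by
    intro k hk
    have h2 := hn1 k (hmem k hk)
    have h3 := abs_integral_monoKernel_sub_le hn (hmem k hk) hρ
    have h4 : ρ⁻¹ ^ (2 * n) ≤ B * (n : ℝ) ^ (-α) :=
      (pow_le_pow_of_le_one (by positivity) hρ1.le (by omega)).trans (hB n hn)
    have h5 : ‖((∑' j, aliasTerm n k j : ℝ) : ℂ) - ((∫ y in (1 : ℝ)..ρ, monoKernel n k y : ℝ) : ℂ)‖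
        ≤ 2 / (1 - ρ⁻¹) * (B * (n : ℝ) ^ (-α) * ρ ^ k.natAbs) := by
      rw [← ofReal_sub, norm_real, Real.norm_eq_abs, abs_sub_comm]
      exact h3.trans (by gcongr)
    have e : midCoeff K n k * trapErr n (fun t => exp (k * t * I) * w t) -
        (w (2 * Real.pi) - w 0) * I *
          (midCoeff K n k * ((∫ y in (1 : ℝ)..ρ, monoKernel n k y : ℝ) : ℂ)) =
        midCoeff K n k * (trapErr n (fun t => exp (k * t * I) * w t) -
          (w (2 * Real.pi) - w 0) * I * (∑' j, aliasTerm n k j : ℝ)) +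
        midCoeff K n k * ((w (2 * Real.pi) - w 0) * I * (((∑' j, aliasTerm n k j : ℝ) : ℂ) -
          ((∫ y in (1 : ℝ)..ρ, monoKernel n k y : ℝ) : ℂ))) := by ring
    rw [e]
    refine (norm_add_le _ _).trans ?_
    rw [norm_mul, norm_mul, norm_mul _ (_ - _), ← hD, one_pow, mul_one]
    calc _ ≤ ‖midCoeff K n k‖ * (C₁ * (n : ℝ) ^ (-α)) +
          ‖midCoeff K n k‖ * (D * (2 / (1 - ρ⁻¹) * (B * (n : ℝ) ^ (-α) * ρ ^ k.natAbs))) := by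
          gcongr
      _ = _ := by ring
  refine (norm_sum_le_of_le _ hterm).trans ?_
  rw [Finset.sum_add_distrib, ← Finset.sum_mul, ← Finset.sum_mul]
  have hb1 := sum_norm_midCoeff_mul_le hc hq0.le zero_le_one (by simpa using hq1) n
    (Finset.Icc (-n : ℤ) n)
  have hb2 := sum_norm_midCoeff_mul_le hc hq0.le hρ0.le hqρ n (Finset.Icc (-n : ℤ) n)
  calc _ ≤ S₁ * (C₁ * (n : ℝ) ^ (-α)) + S₂ * (D * (2 / (1 - ρ⁻¹)) * (B * (n : ℝ) ^ (-α))) := by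
        gcongr
    _ = _ := by ring

theorem exists_norm_integral_tail_le {w : ℝ → ℂ} (hw : Continuous w)
    (hc : ∀ m, ‖laurentCoeff K m‖ ≤ M * q ^ m.natAbs) (hq0 : 0 ≤ q) (hq1 : q < 1) :
    ∃ C, 0 ≤ C ∧ ∀ n : ℕ, ‖∫ t in (0 : ℝ)..(2 * Real.pi),
      (laurentPlus K n (exp (t * I)) + laurentMinus K n (exp (t * I))) * w t‖ ≤ C * q ^ n := by
  have hM : 0 ≤ M := by simpa using (norm_nonneg _).trans (hc 0)
  have h1q : 0 < 1 - q := by linarith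
  have hpi := Real.pi_pos
  obtain ⟨W, hW⟩ := (isCompact_Icc (a := (0 : ℝ)) (b := 2 * Real.pi)).exists_bound_of_continuousOn
    hw.continuousOn
  have hW0 : 0 ≤ W := (norm_nonneg _).trans (hW 0 ⟨le_rfl, by positivity⟩)
  refine ⟨2 * (M / (1 - q)) * W * (2 * Real.pi), by positivity, fun n => ?_⟩
  have h := intervalIntegral.norm_integral_le_of_norm_le_const (a := 0) (b := 2 * Real.pi)
    (f := fun t : ℝ => (laurentPlus K n (exp (t * I)) + laurentMinus K n (exp (t * I))) * w t)
    (C := 2 * (M / (1 - q) * q ^ n) * W) (fun t ht => by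
      rw [Set.uIoc_of_le (by positivity)] at ht
      have hn : ‖exp (t * I)‖ = 1 := norm_exp_ofReal_mul_I t
      rw [norm_mul]
      refine mul_le_mul ?_ (hW t ⟨ht.1.le, ht.2⟩) (norm_nonneg _) (by positivity)
      rw [two_mul]
      exact (norm_add_le _ _).trans (add_le_add (norm_laurentPlus_le hc hq0 hq1 n hn.le)
        (norm_laurentMinus_le hc hq0 hq1 n hn.ge)))
  rw [sub_zero, abs_of_pos (by positivity)] at h
  refine h.trans (le_of_eq ?_)
  ring

end

theorem trapezoid_eq_trapSum (u K : ℂ → ℂ) (u₀ u₁ : ℂ) {n : ℕ} (hn : 1 ≤ n) :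
    trapezoid (2 * n) (fun z => laurentMid K n z * u z) (laurentMid K n 1 * u₀)
      (laurentMid K n 1 * u₁) =
    trapSum n (fun t => laurentMid K n (exp (t * I)) * circleFun u u₀ u₁ t) := by
  have hn' : (n : ℂ) ≠ 0 := by exact_mod_cast (by omega : n ≠ 0)
  have hnr : (0 : ℝ) < n := by exact_mod_cast hn
  have hpi := Real.pi_pos
  have h2pi : exp (((2 * Real.pi : ℝ) : ℂ) * I) = 1 := by
    have := exp_int_mul_two_pi 1
    rwa [Int.cast_one, one_mul] at this
  have hsum : ∑ k ∈ Finset.Ico 1 (2 * n), laurentMid K n (exp (2 * Real.pi * I * k / (2 * n : ℕ))) *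
        u (exp (2 * Real.pi * I * k / (2 * n : ℕ))) =
      ∑ j ∈ Finset.Ico 1 (2 * n), laurentMid K n (exp (((Real.pi * j / n : ℝ) : ℂ) * I)) *
        circleFun u u₀ u₁ (Real.pi * j / n) := by
    refine Finset.sum_congr rfl fun j hj => ?_
    rw [Finset.mem_Ico] at hj
    have hj1 : (0 : ℝ) < j := by exact_mod_cast hj.1
    have hj2 : (j : ℝ) < 2 * n := by exact_mod_cast hj.2
    have hmem : Real.pi * j / n ∈ Set.Ioo 0 (2 * Real.pi) := by
      refine ⟨by positivity, ?_⟩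
      rw [div_lt_iff₀ hnr]
      nlinarith
    have e : 2 * Real.pi * I * j / (2 * n : ℕ) = ((Real.pi * j / n : ℝ) : ℂ) * I := by
      push_cast
      field_simp
    rw [circleFun_of_mem _ _ _ hmem, e, mul_comm I]
  rw [trapezoid, trapSum, hsum, circleFun_zero, circleFun_two_pi, h2pi, ofReal_zero, zero_mul,
    exp_zero]
  congr 1
  push_cast
  field_simp

theorem continuous_comp_circle {K : ℂ → ℂ} {ρ : ℝ} (hρ : 1 ≤ ρ)
    (hK : AnalyticOnNhd ℂ K (annulus ρ)) : Continuous fun t : ℝ => K (exp (t * I)) := by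
  refine hK.continuousOn.comp_continuous (by fun_prop) fun t => ?_
  rw [annulus, Set.mem_ofPred_eq, norm_exp_ofReal_mul_I]
  exact ⟨inv_le_one_of_one_le₀ hρ, hρ⟩

theorem trapezoid_sub_circleInt {u K : ℂ → ℂ} {u₀ u₁ : ℂ} {ρ : ℝ} (hρ : 1 ≤ ρ)
    (hK : AnalyticOnNhd ℂ K (annulus ρ))
    (hL : ∀ z ∈ annulus ρ, HasSum (fun m : ℤ => laurentCoeff K m * z ^ m) (K z))
    (hw : Continuous (circleFun u u₀ u₁)) {n : ℕ} (hn : 1 ≤ n) :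
    trapezoid (2 * n) (fun z => laurentMid K n z * u z) (laurentMid K n 1 * u₀)
      (laurentMid K n 1 * u₁) - circleInt (fun z => K z * u z) =
    trapErr n (fun t => laurentMid K n (exp (t * I)) * circleFun u u₀ u₁ t) -
      ∫ t in (0 : ℝ)..(2 * Real.pi),
        (laurentPlus K n (exp (t * I)) + laurentMinus K n (exp (t * I))) * circleFun u u₀ u₁ t := by
  have hKc := continuous_comp_circle hρ hK
  have hmid : Continuous fun t : ℝ => laurentMid K n (exp (t * I)) :=
    (continuousOn_laurentMid K hn).comp_continuous (by fun_prop) fun t => exp_ne_zero _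
  have hann : ∀ t : ℝ, exp (t * I) ∈ annulus ρ := fun t => by
    rw [annulus, Set.mem_ofPred_eq, norm_exp_ofReal_mul_I]
    exact ⟨inv_le_one_of_one_le₀ hρ, hρ⟩
  have hdec : ∀ t : ℝ, laurentPlus K n (exp (t * I)) + laurentMinus K n (exp (t * I)) =
      K (exp (t * I)) - laurentMid K n (exp (t * I)) := fun t => by
    rw [eq_laurentMid_add hn (hL _ (hann t))]; ring
  have hint : circleInt (fun z => K z * u z) =
      ∫ t in (0 : ℝ)..(2 * Real.pi), K (exp (t * I)) * circleFun u u₀ u₁ t := by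
    rw [integral_mul_circleFun fun t : ℝ => K (exp (t * I)), circleInt]
    simp only [mul_comm I]
  have i1 : IntervalIntegrable (fun t : ℝ => K (exp (t * I)) * circleFun u u₀ u₁ t) volume 0
      (2 * Real.pi) := (hKc.mul hw).intervalIntegrable _ _
  have i2 : IntervalIntegrable (fun t : ℝ => laurentMid K n (exp (t * I)) * circleFun u u₀ u₁ t)
      volume 0 (2 * Real.pi) := (hmid.mul hw).intervalIntegrable _ _
  simp only [hdec, sub_mul]
  rw [trapezoid_eq_trapSum u K u₀ u₁ hn, hint, trapErr,
    intervalIntegral.integral_sub i1 i2]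
  ring

end ModifiedTrapezoid

theorem mainTheorem3 (u K : ℂ → ℂ) (r α κ : ℝ) (u₀ u₁ C₃ C₄ : ℂ)
    (hr : 1 < r) (hα : 1 < α) (hκ : 0 < κ)
    (hu : AnalyticOnNhd ℂ u (ModifiedTrapezoid.cutAnnulus r))
    (hu₀ : (fun t : ℂ => u (exp (I * t)) - (u₀ + C₃ * t ^ ((α - 1 : ℝ) : ℂ)))
      =o[𝓝[ModifiedTrapezoid.sector κ] 0] (fun t : ℂ => ‖t‖ ^ (α - 1)))
    (hu₁ : (fun s : ℂ => u (exp (I * (2 * Real.pi - s))) - (u₁ + C₄ * s ^ ((α - 1 : ℝ) : ℂ)))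
      =o[𝓝[ModifiedTrapezoid.sector κ] 0] (fun s : ℂ => ‖s‖ ^ (α - 1)))
    (hK : AnalyticOnNhd ℂ K (Metric.sphere 0 1)) :
    IntervalIntegrable (fun t : ℝ => K (exp (I * t)) * u (exp (I * t))) volume 0 (2 * Real.pi) ∧
    (∃ ρ : ℝ, 1 < ρ ∧ ρ ≤ r ∧ AnalyticOnNhd ℂ K (ModifiedTrapezoid.annulus ρ)) ∧
    ∀ ρ : ℝ, 1 < ρ → ρ ≤ r → AnalyticOnNhd ℂ K (ModifiedTrapezoid.annulus ρ) →
      ∃ J : ℕ → ℂ,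
        (∀ n : ℕ, 1 ≤ n → ModifiedTrapezoid.IsPrincipalValue
          (fun x : ℝ => ModifiedTrapezoid.correctionKernel K n x * (u₀ - u₁) * (1 / (I * x)))
          ρ⁻¹ 1 ρ (J n)) ∧
        (fun n : ℕ =>
            ModifiedTrapezoid.trapezoid (2 * n)
                (fun z => ModifiedTrapezoid.laurentMid K n z * u z)
                (ModifiedTrapezoid.laurentMid K n 1 * u₀)
                (ModifiedTrapezoid.laurentMid K n 1 * u₁)
              - ModifiedTrapezoid.circleInt (fun z => K z * u z) - J n)
          =O[atTop] (fun n : ℕ => (n : ℝ) ^ (-α)) := by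
  open ModifiedTrapezoid in
  obtain ⟨δ₀, hδ₀, hb₀⟩ := exists_norm_sub_le_of_isLittleO hu₀
  obtain ⟨δ₁, hδ₁, hb₁⟩ := exists_norm_sub_le_of_isLittleO hu₁
  set C := 1 + max ‖C₃‖ ‖C₄‖ with hCdef
  have hC : 0 ≤ C := by positivity
  have hδ : 0 < min δ₀ δ₁ := lt_min hδ₀ hδ₁
  have h₀ : ∀ t ∈ sector κ, ‖t‖ ≤ min δ₀ δ₁ → ‖u (exp (I * t)) - u₀‖ ≤ C * ‖t‖ ^ (α - 1) :=
    fun t ht htδ => (hb₀ t ht (htδ.trans (min_le_left _ _))).trans (by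
      gcongr; exact add_le_add_right (le_max_left _ _) _)
  have h₁ : ∀ t ∈ sector κ, ‖t‖ ≤ min δ₀ δ₁ →
      ‖u (exp (I * (2 * Real.pi - t))) - u₁‖ ≤ C * ‖t‖ ^ (α - 1) :=
    fun t ht htδ => (hb₁ t ht (htδ.trans (min_le_right _ _))).trans (by
      gcongr; exact add_le_add_right (le_max_right _ _) _)
  have hw := continuous_circleFun hr hα hκ hC hδ hu h₀ h₁
  have hdecay := circleFun_decay hr hα hκ hC hδ hu h₀ h₁
  rw [← annulus_one] at hK
  refine ⟨?_, ?_, ?_⟩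
  · have := intervalIntegrable_mul_comp_exp hw (continuous_comp_circle le_rfl hK)
    simpa only [mul_comm I] using this
  · obtain ⟨s, hs, hKs⟩ := exists_analyticOnNhd_annulus le_rfl hK
    exact ⟨min s r, lt_min hs hr, min_le_right _ _,
      hKs.mono (annulus_mono (lt_min (by linarith) (by linarith)) (min_le_left _ _))⟩
  intro ρ hρ _ hKρ
  obtain ⟨M, q, hM, hq0, hqρ, hc, hL⟩ := exists_laurent_bound hρ hKρ
  have hq1 : q < 1 := by nlinarith
  have h1q : 0 < 1 - q := by linarith
  set Jm : ℕ → ℂ := fun n => ∑ k ∈ Finset.Icc (-n : ℤ) n,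
    midCoeff K n k * ((∫ y in (1 : ℝ)..ρ, monoKernel n k y : ℝ) : ℂ) with hJm
  set Jp : ℕ → ℂ := fun n => ∫ x in ρ⁻¹..1, laurentPlus K n x / x with hJp
  set Jq : ℕ → ℂ := fun n => ∫ x in (1 : ℝ)..ρ, laurentMinus K n x / x with hJq
  refine ⟨fun n => (u₁ - u₀) * I * (Jm n + Jp n - Jq n), fun n hn => ?_, ?_⟩
  · convert (isPrincipalValue_correctionKernel hρ hc hq0.le hq1 hL hn).const_mul
      ((u₁ - u₀) * I) using 2 with x
    rw [one_div, mul_inv, inv_I]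
    ring
  obtain ⟨C₁, hC₁, hT⟩ := exists_norm_trapErr_laurentMid_sub_le hw hα (circleFun_zero u u₀ u₁)
    (circleFun_two_pi u u₀ u₁) hdecay hρ hc hq0 hqρ
  obtain ⟨C₂, hC₂, hTail⟩ := exists_norm_integral_tail_le hw hc hq0.le hq1
  obtain ⟨B, hB0, hB⟩ := exists_pow_le_rpow (α := α) (by linarith) hq0 hq1
  set D := ‖(u₁ - u₀) * I‖ with hD
  set A := M / (1 - q) * ρ with hA
  have hA0 : 0 ≤ A := by positivity
  refine IsBigO.of_bound (C₁ + C₂ * B + D * (A + A) * B) ?_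
  filter_upwards [hT, eventually_ge_atTop 1] with n hn1 hn
  rw [trapezoid_sub_circleInt hρ.le hKρ hL hw hn, Real.norm_of_nonneg (by positivity)]
  have hp := norm_integral_laurentPlus_le hρ hc hM hq0.le hq1 n
  have hm := norm_integral_laurentMinus_le hρ hc hM hq0.le hq1 n
  have ht := hTail n
  have hq := hB n hn
  set T := trapErr n (fun t => laurentMid K n (exp (t * I)) * circleFun u u₀ u₁ t)
  set X := ∫ t in (0 : ℝ)..(2 * Real.pi),
    (laurentPlus K n (exp (t * I)) + laurentMinus K n (exp (t * I))) * circleFun u u₀ u₁ t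
  have e : T - X - (u₁ - u₀) * I * (Jm n + Jp n - Jq n) =
      (T - (u₁ - u₀) * I * Jm n) - X - (u₁ - u₀) * I * (Jp n - Jq n) := by ring
  rw [e]
  calc _ ≤ ‖T - (u₁ - u₀) * I * Jm n‖ + ‖X‖ + D * (‖Jp n‖ + ‖Jq n‖) := by
        refine (norm_sub_le _ _).trans (add_le_add (norm_sub_le _ _) ?_)
        rw [norm_mul]
        exact mul_le_mul_of_nonneg_left (norm_sub_le _ _) (norm_nonneg _)
    _ ≤ C₁ * (n : ℝ) ^ (-α) + C₂ * q ^ n + D * (A * q ^ n + A * q ^ n) := by gcongr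
    _ = C₁ * (n : ℝ) ^ (-α) + (C₂ + D * (A + A)) * q ^ n := by ring
    _ ≤ C₁ * (n : ℝ) ^ (-α) + (C₂ + D * (A + A)) * (B * (n : ℝ) ^ (-α)) := by gcongr
    _ = _ := by ring
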